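/- A \emph{toroidal map} is a finite connected graph embedded in the torus such that every vertex is at least 3-valent and every face (the closure of a component of the complement of the graph) is a closed 2-cell; multiple edges are allowed. A \emph{toroidal polyhedral map} (TPM) is a toroidal map without loops or multiple edges in which any two distinct faces meet in a set that is empty or connected. An edge of a TPM is \emph{removable} if deleting it, and coalescing the two edges at each resulting 2-valent vertex, gives a TPM; it is \emph{shrinkable} if contracting it, and replacing the two edges of each resulting two-sided face by a single edge, gives a TPM. A TPM is \emph{diminimal} if it has no removable and no shrinkable edge. \emph{Edge adding} is the passage from a toroidal map $G$ to a toroidal map $G'$ by adding an edge $e$ across a face of $G$, where each end of $e$ is a vertex of $G$ or a new vertex in the interior of an edge of $G$, and no edge of $G$ contains both ends of $e$. A cycle $C$ (a closed path without repeated vertices or edges) in a map is a \emph{planar cycle} if it divides the torus into two regions one of which is simply connected (the planar region enclosed by $C$). A map \emph{contains an e-i-c} (an edge inside a cycle) if for some planar cycle $C$ of the map there is an edge that lies in the planar region enclosed by $C$ and is disjoint from $C$ (in particular neither of its ends is on $C$). Let $G$ be a toroidal map such that $G$ or its dual map contains an e-i-c. Then no diminimal TPM can be obtained from $G$ by a finite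 (possibly empty) sequence of edge addings. -/

import Mathlib

/-- A finite graph drawn on a closed oriented surface so that all faces are open cells, encoded by
its rotation system.  A dart is an edge together with one of its two directions; `rot` sends a dart
to the next dart in the cyclic order around its initial vertex, and `inv` reverses a dart.
Multiple edges and loops are allowed at this stage. -/
structure CMap where
  Dart : Type
  finite : Finite Dart
  rot : Equiv.Perm Dart
  inv : Equiv.Perm Dart
  inv_inv : ∀ d, inv (inv d) = d
  inv_ne : ∀ d, inv d ≠ d

namespace CMap

/-- The face permutation: run along the dart, then take the next dart around its end. -/
def facePerm (G : CMap) : Equiv.Perm G.Dart := G.rot * G.inv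

/-- Vertices, edges and faces are the cycles of `rot`, `inv` and `facePerm`. -/
def Vert (G : CMap) : Type := Quotient (Equiv.Perm.SameCycle.setoid G.rot)

def Edge (G : CMap) : Type := Quotient (Equiv.Perm.SameCycle.setoid G.inv)

def Face (G : CMap) : Type := Quotient (Equiv.Perm.SameCycle.setoid G.facePerm)

/-- The initial vertex of a dart; its terminal vertex is `G.vert (G.inv d)`. -/
def vert (G : CMap) (d : G.Dart) : G.Vert :=
  Quotient.mk (Equiv.Perm.SameCycle.setoid G.rot) d

/-- The undirected edge of a dart. -/
def edge (G : CMap) (d : G.Dart) : G.Edge :=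
  Quotient.mk (Equiv.Perm.SameCycle.setoid G.inv) d

/-- The face whose boundary walk runs through the dart.  The face on the other side of the same
edge is `G.face (G.inv d)`. -/
def face (G : CMap) (d : G.Dart) : G.Face :=
  Quotient.mk (Equiv.Perm.SameCycle.setoid G.facePerm) d

/-- The dual map: one vertex in each face, one edge across each edge, one face around each
vertex.  The face permutation of the dual is `G.rot` (because `inv` is an involution). -/
def dual (G : CMap) : CMap where
  Dart := G.Dart
  finite := G.finite
  rot := G.facePerm
  inv := G.inv
  inv_inv := G.inv_inv
  inv_ne := G.inv_ne

/-! ### Maps on the torus -/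

/-- The underlying graph (equivalently, the underlying surface) is connected. -/
def IsConnected (G : CMap) : Prop :=
  ∀ a b : G.Dart, Relation.ReflTransGen (fun x y => y = G.rot x ∨ y = G.inv x) a b

/-- The underlying surface is the torus: connected, orientable, of Euler characteristic `0`. -/
def OnTorus (G : CMap) : Prop :=
  Nonempty G.Dart ∧ G.IsConnected ∧
    (Nat.card G.Vert : ℤ) - (Nat.card G.Edge : ℤ) + (Nat.card G.Face : ℤ) = 0

/-- The number of edge ends at a vertex. -/
noncomputable def valence (G : CMap) (v : G.Vert) : ℕ := {d | G.vert d = v}.ncard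

/-- A map on the torus: every vertex is at least 3-valent, and every (closed) face is a closed
2-cell, that is, its boundary walk passes at most once through each vertex.  Loops are impossible
then; multiple edges are not excluded here. -/
structure IsToroidalMap (G : CMap) : Prop where
  onTorus : G.OnTorus
  three_le_valence : ∀ v, 3 ≤ G.valence v
  closedCell : ∀ d d', G.face d = G.face d' → G.vert d = G.vert d' → d = d'

/-- No loops and no multiple edges. -/
def IsSimple (G : CMap) : Prop :=
  (∀ d, G.vert d ≠ G.vert (G.inv d)) ∧
    ∀ d d', G.vert d = G.vert d' → G.vert (G.inv d) = G.vert (G.inv d') → d = d'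

/-- The vertex `v` lies on the closed face `f`. -/
def VertOn (G : CMap) (v : G.Vert) (f : G.Face) : Prop :=
  ∃ d, G.vert d = v ∧ G.face d = f

/-- The edge of the dart `d` lies on the closed face `f`. -/
def EdgeOn (G : CMap) (d : G.Dart) (f : G.Face) : Prop :=
  G.face d = f ∨ G.face (G.inv d) = f

/-- Two faces meet properly: their intersection, which consists of the vertices and edges lying on
both, is empty or connected. -/
def MeetProperly (G : CMap) (f g : G.Face) : Prop :=
  ∀ v w, G.VertOn v f → G.VertOn v g → G.VertOn w f → G.VertOn w g →
    Relation.ReflTransGen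
      (fun x y => ∃ d, G.vert d = x ∧ G.vert (G.inv d) = y ∧ G.EdgeOn d f ∧ G.EdgeOn d g) v w

/-- A toroidal polyhedral map. -/
structure IsTPM (G : CMap) : Prop where
  isToroidalMap : G.IsToroidalMap
  isSimple : G.IsSimple
  meetProperly : ∀ f g, f ≠ g → G.MeetProperly f g

/-! ### Removing, shrinking and adding edges -/

/-- `H` arises from `G` by deleting the edge of the dart `d`, whose two sides belong to different
faces (so that these two faces are united): the darts of `H` are the other darts of `G`, reversal
is inherited, and the cyclic order around each vertex is obtained by skipping the deleted darts. -/
def IsDeletion (G : CMap) (d : G.Dart) (H : CMap) : Prop :=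
  G.face d ≠ G.face (G.inv d) ∧
  ∃ ι : H.Dart → G.Dart, Function.Injective ι ∧
    (∀ x, (∃ a, ι a = x) ↔ x ≠ d ∧ x ≠ G.inv d) ∧
    (∀ a, ι (H.inv a) = G.inv (ι a)) ∧
    ∀ a, ∃ k : ℕ, 0 < k ∧ ι (H.rot a) = (G.rot ^ k) (ι a) ∧
      ∀ j : ℕ, 0 < j → j < k → (G.rot ^ j) (ι a) = d ∨ (G.rot ^ j) (ι a) = G.inv d

/-- `H` arises from `G` by contracting the edge of the dart `d`, whose two ends are different
vertices (so that these two vertices are united): the boundary walk of each face is obtained by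
skipping the contracted darts.  This is deletion of the crossing edge in the dual. -/
def IsContraction (G : CMap) (d : G.Dart) (H : CMap) : Prop :=
  IsDeletion G.dual d H.dual

/-- `H'` arises from `H` by coalescing the two edges at a 2-valent vertex into one edge
(contracting one of the two has this effect). -/
def Coalesce (H H' : CMap) : Prop :=
  ∃ a, H.rot a ≠ a ∧ H.rot (H.rot a) = a ∧ IsContraction H a H'

/-- `H'` arises from `H` by replacing the two edges of a two-sided face by a single edge
(deleting one of the two has this effect). -/
def MergeDigon (H H' : CMap) : Prop :=
  ∃ a, H.facePerm a ≠ a ∧ H.facePerm (H.facePerm a) = a ∧ IsDeletion H a H'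

/-- `G'` is obtained from `G` by removing the edge of `d` and coalescing edges at the resulting
2-valent vertices. -/
def RemovesTo (G : CMap) (d : G.Dart) (G' : CMap) : Prop :=
  ∃ H, IsDeletion G d H ∧ Relation.ReflTransGen Coalesce H G'

/-- `G'` is obtained from `G` by shrinking the edge of `d` and replacing the two edges of each
resulting two-sided face by a single edge. -/
def ShrinksTo (G : CMap) (d : G.Dart) (G' : CMap) : Prop :=
  ∃ H, IsContraction G d H ∧ Relation.ReflTransGen MergeDigon H G'

def Removable (G : CMap) (d : G.Dart) : Prop := ∃ G', G'.IsTPM ∧ G.RemovesTo d G'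

def Shrinkable (G : CMap) (d : G.Dart) : Prop := ∃ G', G'.IsTPM ∧ G.ShrinksTo d G'

/-- A diminimal toroidal polyhedral map: no edge is removable and no edge is shrinkable. -/
structure IsDiminimalTPM (G : CMap) : Prop where
  isTPM : G.IsTPM
  not_removable : ∀ d, ¬ G.Removable d
  not_shrinkable : ∀ d, ¬ G.Shrinkable d

/-- The toroidal map `G'` is obtained from the toroidal map `G` by adding one edge `e` (the edge of
the dart `d` of `G'`) across a face of `G`: this is the inverse of removing `e`.  An end of `e` is
either a vertex of `G`, or a new vertex inside an edge of `G`; after removal of `e` a new end is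
2-valent and disappears by coalescing.  No edge of `G` contains both ends of `e`: since only the
ends of `e` can subdivide edges of `G`, this says that no other edge of `G'` joins them. -/
def AddsEdge (G G' : CMap) : Prop :=
  G.IsToroidalMap ∧ G'.IsToroidalMap ∧
  ∃ d, G'.RemovesTo d G ∧
    ∀ a, G'.vert a = G'.vert d → G'.vert (G'.inv a) = G'.vert (G'.inv d) → a = d

/-! ### Planar cycles -/

/-- A cycle of length `n + 1` in the graph: a closed path (indices are cyclic) without repeated
vertices or edges, given by its consecutive darts. -/
structure Cycle (G : CMap) where
  n : ℕ
  dart : Fin (n + 1) → G.Dart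
  closed : ∀ i, G.vert (G.inv (dart i)) = G.vert (dart (i + 1))
  vert_injective : Function.Injective fun i => G.vert (dart i)
  edge_injective : Function.Injective fun i => G.edge (dart i)

/-- A set of faces whose (closed) union is a region: nonempty and connected. -/
def IsRegion (G : CMap) (R : Set G.Face) : Prop :=
  R.Nonempty ∧ ∀ f ∈ R, ∀ g ∈ R,
    Relation.ReflTransGen (fun x y => y ∈ R ∧ ∃ v, G.VertOn v x ∧ G.VertOn v y) f g

/-- The Euler characteristic of the union of the closed faces in `R`. -/
noncomputable def eulerChar (G : CMap) (R : Set G.Face) : ℤ :=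
  ({v | ∃ d, G.vert d = v ∧ G.face d ∈ R}.ncard : ℤ)
    - ({e | ∃ d, G.edge d = e ∧ G.face d ∈ R}.ncard : ℤ) + (R.ncard : ℤ)

/-- A planar (simply connected) region.  A connected union of closed faces other than the whole
torus has second Betti number `0`, so its Euler characteristic is `1` exactly if it is simply
connected; the whole torus is not simply connected and has Euler characteristic `0`. -/
def IsPlanarRegion (G : CMap) (R : Set G.Face) : Prop :=
  G.IsRegion R ∧ G.eulerChar R = 1

/-- The cycle `C` divides the torus into the two regions `R` and `Rᶜ` (one passes between them
precisely across the edges of `C`), and `R` is planar.  So `C` is a planar cycle, and `R` is the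
planar region enclosed by it. -/
def Cycle.Encloses {G : CMap} (C : G.Cycle) (R : Set G.Face) : Prop :=
  G.IsPlanarRegion R ∧ G.IsRegion Rᶜ ∧
    ∀ d, ¬(G.face d ∈ R ↔ G.face (G.inv d) ∈ R) ↔ ∃ i, G.edge (C.dart i) = G.edge d

/-- There is an edge inside a planar cycle (e-i-c): an edge (of the dart `d`) that lies in the
planar region enclosed by a planar cycle and is disjoint from that cycle, so that neither end of the
edge is a vertex of the cycle. -/
def HasEIC (G : CMap) : Prop :=
  ∃ (C : G.Cycle) (R : Set G.Face) (d : G.Dart), C.Encloses R ∧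
    G.face d ∈ R ∧ G.face (G.inv d) ∈ R ∧
    ∀ i, G.vert (C.dart i) ≠ G.vert d ∧ G.vert (C.dart i) ≠ G.vert (G.inv d)

end CMap

/-!
The proof is cohomological.  A set of faces is called acyclic if on its union every cocycle modulo
2 is a coboundary, and a map has an inner edge if some acyclic set contains all faces around both
ends of some edge.

The planar region enclosed by a planar cycle is acyclic (`CMap.acyclic_of_planar`): its cochain
complex has Euler characteristic `1`, connectedness makes `H⁰` one-dimensional, and `H²` vanishes
because the region is not the whole torus.  So an edge inside a cycle is an inner edge.  Inner
edges are easy to follow backwards through deletions and contractions of edges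
(`CMap.DeletionMap.hasInnerEdge`, `CMap.ContractionMap.hasInnerEdge`), because cochains restrict
and potentials extend.  The coalescing of edges is a contraction, and duality exchanges deletions
with contractions, so edge addings preserve inner edges both of a map and of its dual.

It remains to see that a diminimal map has no inner edge; as the dual of a diminimal map is
diminimal, this covers both cases.  Let `e` be an edge of a toroidal polyhedral map, with ends `u`,
`v` and sides `F₁`, `F₂`.  If `e` is not removable, then a face `F₃` meets `F₁` and `F₂` but
contains neither `u` nor `v` (`CMap.IsTPM.removable`); this gives a closed curve that crosses `e`,
passes from `F₂` to `F₃` and on to `F₁` through two vertices, and returns.  Dually, if `e` is not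
shrinkable, then a vertex `w` off `F₁` and `F₂` shares a face with `u` and a face with `v`; this
gives a closed curve along `e` and through these two faces and `w`.  The two curves meet only where
they cross, once, in `e`.  If `e` is an inner edge, then the second curve runs in an acyclic set,
where the cocycle of edges crossed by the first curve has a potential, so it crosses the first
curve an even number of times (`CMap.Acyclic.not_obstructed`).
-/

namespace CMap

open Equiv Equiv.Perm

/-! ### Cycles of permutations -/

/-- If `τ` is the first return map of `σ` to the range of `ι`, then the cycles of `τ` are the traces
of the cycles of `σ`. -/
theorem sameCycle_iff_of_firstReturn {X Y : Type*} [Finite X] [Finite Y] {σ : Perm X} {τ : Perm Y}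
    {ι : Y → X} (hι : Function.Injective ι)
    (h : ∀ a, ∃ k : ℕ, 0 < k ∧ ι (τ a) = (σ ^ k) (ι a) ∧
      ∀ j : ℕ, 0 < j → j < k → (σ ^ j) (ι a) ∉ Set.range ι) (a b : Y) :
    τ.SameCycle a b ↔ σ.SameCycle (ι a) (ι b) := by
  constructor
  · intro hab
    obtain ⟨n, -, rfl⟩ := hab.exists_pow_eq'
    clear hab
    induction n with
    | zero => exact SameCycle.refl _ _
    | succ n ih =>
      obtain ⟨k, -, hk, -⟩ := h ((τ ^ n) a)
      rw [pow_succ', Perm.mul_apply, hk]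
      exact sameCycle_pow_right.2 ih
  · intro hab
    obtain ⟨n, -, hn⟩ := hab.exists_pow_eq'
    clear hab
    induction n using Nat.strong_induction_on generalizing a with
    | _ n ih =>
      rcases Nat.eq_zero_or_pos n with rfl | hpos
      · rw [hι hn]
      · obtain ⟨k, hk, hk', hj⟩ := h a
        have hkn : k ≤ n := by
          by_contra hlt
          exact hj n hpos (by omega) ⟨b, hn.symm⟩
        refine (sameCycle_apply_left (f := τ)).1 (ih (n - k) (by omega) (τ a) ?_)
        rw [hk', ← Perm.mul_apply, ← pow_add, Nat.sub_add_cancel hkn, hn]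

theorem sameCycle_mul_swap [Finite X] [DecidableEq X] {σ : Perm X} {x y : X}
    (h : ¬ σ.SameCycle x y) : (σ * swap x y).SameCycle x y := by
  have hex : ∃ n : ℕ, 0 < n ∧ (σ ^ n) y = y :=
    ⟨orderOf σ, orderOf_pos σ, by rw [pow_orderOf_eq_one]; rfl⟩
  classical
  obtain ⟨hn, hny⟩ := Nat.find_spec hex
  have key : ∀ j : ℕ, 0 < j → j ≤ Nat.find hex →
      ((σ * swap x y) ^ j) x = (σ ^ j) y := by
    intro j hj
    induction j, hj using Nat.le_induction with
    | base => intro _; simp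
    | succ j hj ih =>
      intro hle
      have hxj : (σ ^ j) y ≠ x := fun e => h (by rw [← e]; exact sameCycle_pow_left.2 (.refl _ _))
      have hyj : (σ ^ j) y ≠ y := fun e => Nat.find_min hex (m := j) (by omega) ⟨hj, e⟩
      rw [pow_succ', Perm.mul_apply, ih (by omega), Perm.mul_apply, swap_apply_of_ne_of_ne hxj hyj,
        pow_succ', Perm.mul_apply]
  have := key _ hn le_rfl
  rw [hny] at this
  exact ⟨(Nat.find hex : ℕ), by rw [zpow_natCast]; exact this⟩

/-- Multiplying by the transposition of two points on different cycles unites these cycles. -/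
theorem sameCycle_mul_swap_iff [Finite X] [DecidableEq X] {σ : Perm X} {x y : X}
    (h : ¬ σ.SameCycle x y) (a b : X) :
    (σ * swap x y).SameCycle a b ↔ σ.SameCycle a b ∨
      ((σ.SameCycle x a ∨ σ.SameCycle y a) ∧ (σ.SameCycle x b ∨ σ.SameCycle y b)) := by
  have hxy := sameCycle_mul_swap h
  have sub : ∀ {a b}, σ.SameCycle a b → (σ * swap x y).SameCycle a b := by
    intro a b hab
    obtain ⟨n, -, rfl⟩ := hab.exists_pow_eq'
    clear hab
    induction n with
    | zero => exact SameCycle.refl _ _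
    | succ n ih =>
      refine ih.trans ?_
      rw [pow_succ', Perm.mul_apply]
      generalize (σ ^ n) a = z
      by_cases hx : z = x
      · subst hx
        refine hxy.trans ?_
        have : σ z = (σ * swap z y) y := by simp
        rw [this]
        exact sameCycle_apply_right.2 (.refl _ _)
      by_cases hy : z = y
      · subst hy
        refine hxy.symm.trans ?_
        have : σ z = (σ * swap x z) x := by simp
        rw [this]
        exact sameCycle_apply_right.2 (.refl _ _)
      · have : σ z = (σ * swap x y) z := by
          rw [Perm.mul_apply, swap_apply_of_ne_of_ne hx hy]
        rw [this]
        exact sameCycle_apply_right.2 (.refl _ _)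
  constructor
  · intro hab
    obtain ⟨n, -, rfl⟩ := hab.exists_pow_eq'
    clear hab
    induction n with
    | zero => exact .inl (.refl _ _)
    | succ n ih =>
      rw [pow_succ', Perm.mul_apply]
      revert ih
      generalize ((σ * swap x y) ^ n) a = z
      intro ih
      have hr : ∀ {p q}, σ.SameCycle p (σ q) ↔ σ.SameCycle p q := sameCycle_apply_right
      by_cases hx : z = x
      · subst hx
        rw [Perm.mul_apply, swap_apply_left, hr, hr, hr]
        refine .inr ⟨?_, .inr (.refl _ _)⟩
        rcases ih with ih | ih
        · exact .inl ih.symm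
        · exact ih.1
      by_cases hy : z = y
      · subst hy
        rw [Perm.mul_apply, swap_apply_right, hr, hr, hr]
        refine .inr ⟨?_, .inl (.refl _ _)⟩
        rcases ih with ih | ih
        · exact .inr ih.symm
        · exact ih.1
      · rw [Perm.mul_apply, swap_apply_of_ne_of_ne hx hy, hr, hr, hr]
        exact ih
  · rintro (hab | ⟨ha | ha, hb | hb⟩)
    · exact sub hab
    · exact sub (ha.symm.trans hb)
    · exact (sub ha.symm).trans (hxy.trans (sub hb))
    · exact (sub ha.symm).trans (hxy.symm.trans (sub hb))
    · exact sub (ha.symm.trans hb)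

/-! ### Vertices, edges and faces -/

variable {G H : CMap}

instance (G : CMap) : Finite G.Dart := G.finite
instance (G : CMap) : Finite G.Vert := inferInstanceAs (Finite (Quotient _))
instance (G : CMap) : Finite G.Edge := inferInstanceAs (Finite (Quotient _))
instance (G : CMap) : Finite G.Face := inferInstanceAs (Finite (Quotient _))

attribute [simp] inv_inv

theorem inv_injective (G : CMap) {a b : G.Dart} (h : G.inv a = G.inv b) : a = b :=
  G.inv.injective h

theorem vert_eq_iff {a b : G.Dart} : G.vert a = G.vert b ↔ G.rot.SameCycle a b := Quotient.eq

theorem face_eq_iff {a b : G.Dart} : G.face a = G.face b ↔ G.facePerm.SameCycle a b := Quotient.eq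

@[simp] theorem vert_rot (a : G.Dart) : G.vert (G.rot a) = G.vert a :=
  vert_eq_iff.2 (sameCycle_apply_left.2 (.refl _ _))

@[simp] theorem face_facePerm (a : G.Dart) : G.face (G.facePerm a) = G.face a :=
  face_eq_iff.2 (sameCycle_apply_left.2 (.refl _ _))

theorem facePerm_apply (a : G.Dart) : G.facePerm a = G.rot (G.inv a) := rfl

@[simp] theorem facePerm_inv (a : G.Dart) : G.facePerm (G.inv a) = G.rot a := by
  simp [facePerm_apply]

@[simp] theorem vert_facePerm (a : G.Dart) : G.vert (G.facePerm a) = G.vert (G.inv a) :=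
  vert_rot _

@[simp] theorem face_rot (a : G.Dart) : G.face (G.rot a) = G.face (G.inv a) := by
  rw [← facePerm_inv, face_facePerm]

theorem sameCycle_induction {X : Type*} [Finite X] {σ : Perm X} {P : X → Prop}
    (hP : ∀ x, P x → P (σ x)) {a b : X} (h : σ.SameCycle a b) (ha : P a) : P b := by
  obtain ⟨n, -, rfl⟩ := h.exists_pow_eq'
  clear h
  induction n with
  | zero => exact ha
  | succ n ih => rw [pow_succ', Perm.mul_apply]; exact hP _ ih

theorem edge_eq_iff {a b : G.Dart} : G.edge a = G.edge b ↔ b = a ∨ b = G.inv a := by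
  refine Quotient.eq.trans ⟨fun h => ?_, ?_⟩
  · refine sameCycle_induction (P := fun x => x = a ∨ x = G.inv a) ?_ h (.inl rfl)
    rintro x (rfl | rfl) <;> simp
  · rintro (rfl | rfl)
    · exact SameCycle.refl _ _
    · exact sameCycle_apply_right.2 (.refl _ _)

theorem vert_induction {P : G.Dart → Prop} (hP : ∀ x, P x → P (G.rot x)) {a b : G.Dart}
    (h : G.vert a = G.vert b) (ha : P a) : P b :=
  sameCycle_induction hP (vert_eq_iff.1 h) ha

theorem face_induction {P : G.Dart → Prop} (hP : ∀ x, P x → P (G.facePerm x)) {a b : G.Dart}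
    (h : G.face a = G.face b) (ha : P a) : P b :=
  sameCycle_induction hP (face_eq_iff.1 h) ha

theorem vert_surjective (v : G.Vert) : ∃ d, G.vert d = v := Quotient.exists_rep v
theorem edge_surjective (e : G.Edge) : ∃ d, G.edge d = e := Quotient.exists_rep e
theorem face_surjective (f : G.Face) : ∃ d, G.face d = f := Quotient.exists_rep f

/-! ### Duality -/

@[simp] theorem dual_dual (G : CMap) : G.dual.dual = G := by
  obtain ⟨D, hD, r, i, hi, hne⟩ := G
  have h : r * i * i = r := by ext x; simp [hi]
  simp only [dual, facePerm]
  congr 1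

theorem dual_facePerm (a : G.Dart) : G.dual.facePerm a = G.rot a :=
  facePerm_inv a

theorem dual_face_eq_iff {a b : G.Dart} : G.dual.face a = G.dual.face b ↔ G.vert a = G.vert b := by
  have h : G.dual.facePerm = (G.rot : Perm G.Dart) := Equiv.ext fun a => dual_facePerm (G := G) a
  rw [vert_eq_iff]
  refine face_eq_iff.trans ?_
  rw [h]
  exact Iff.rfl

/-! ### Connectedness -/

theorem IsConnected.forall (h : G.IsConnected) {P : G.Dart → Prop}
    (hr : ∀ x, P x → P (G.rot x)) (hi : ∀ x, P x → P (G.inv x)) {a : G.Dart} (ha : P a)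
    (b : G.Dart) : P b := by
  induction h a b with
  | refl => exact ha
  | tail _ hs ih =>
    rcases hs with rfl | rfl
    exacts [hr _ ih, hi _ ih]

theorem isConnected_of_forall
    (h : ∀ P : G.Dart → Prop, (∀ x, P (G.rot x) ↔ P x) → (∀ x, P (G.inv x) ↔ P x) →
      ∀ a b, P a → P b) : G.IsConnected := by
  intro a b
  set P : G.Dart → Prop :=
    Relation.ReflTransGen (fun x y => y = G.rot x ∨ y = G.inv x) a with hPdef
  have hr : ∀ x, P x → P (G.rot x) := fun x hx => hx.tail (.inl rfl)
  have hi : ∀ x, P x → P (G.inv x) := fun x hx => hx.tail (.inr rfl)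
  refine h P (fun x => ⟨fun hx => ?_, hr x⟩) (fun x => ⟨fun hx => ?_, hi x⟩) a b .refl
  · exact vert_induction hr (vert_rot x) hx
  · simpa using hi _ hx

theorem IsConnected.dual (h : G.IsConnected) : G.dual.IsConnected := by
  refine isConnected_of_forall fun P hr hi a b ha => h.forall (P := P) ?_ ?_ ha b
  · intro x hx
    rw [← facePerm_inv]
    exact (hr _).2 ((hi _).2 hx)
  · exact fun x hx => (hi x).2 hx

theorem OnTorus.dual (h : G.OnTorus) : G.dual.OnTorus := by
  obtain ⟨h1, h2, h3⟩ := h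
  refine ⟨h1, h2.dual, ?_⟩
  have hv : Nat.card G.dual.Vert = Nat.card G.Face := rfl
  have he : Nat.card G.dual.Edge = Nat.card G.Edge := rfl
  have hf : Nat.card G.dual.Face = Nat.card G.Vert := by
    change Nat.card G.dual.dual.Vert = _
    rw [dual_dual]
  rw [hv, he, hf]
  omega

/-! ### Deletion of an edge between two faces -/

/-- The injection `ι` of the darts of `H` into those of `G` shows `H` as `G` without the edge of
`d`, which separates two faces: the vertices are the same, and the two faces at the edge become
one.  This is what is used of `IsDeletion`; applied to the duals it describes contractions. -/
structure DeletionMap (G : CMap) (d : G.Dart) (H : CMap) (ι : H.Dart → G.Dart) : Prop where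
  injective : Function.Injective ι
  range_iff : ∀ x, (∃ a, ι a = x) ↔ x ≠ d ∧ x ≠ G.inv d
  map_inv : ∀ a, ι (H.inv a) = G.inv (ι a)
  face_ne : G.face d ≠ G.face (G.inv d)
  vert_iff : ∀ a b, H.vert a = H.vert b ↔ G.vert (ι a) = G.vert (ι b)
  face_iff : ∀ a b, H.face a = H.face b ↔ G.face (ι a) = G.face (ι b) ∨
    ((G.face (ι a) = G.face d ∨ G.face (ι a) = G.face (G.inv d)) ∧
      (G.face (ι b) = G.face d ∨ G.face (ι b) = G.face (G.inv d)))

theorem IsDeletion.exists_deletionMap {d : G.Dart} (h : IsDeletion G d H) :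
    ∃ ι, DeletionMap G d H ι := by
  classical
  obtain ⟨hne, ι, hι, hr, hi, hrot⟩ := h
  have hmem : ∀ x, x = d ∨ x = G.inv d → x ∉ Set.range ι := by
    rintro x hx ⟨a, rfl⟩
    have := (hr _).1 ⟨a, rfl⟩
    tauto
  refine ⟨ι, hι, hr, hi, hne, fun a b => ?_, fun a b => ?_⟩
  · rw [vert_eq_iff, vert_eq_iff]
    refine sameCycle_iff_of_firstReturn hι (fun a => ?_) a b
    obtain ⟨k, hk, hk', hj⟩ := hrot a
    exact ⟨k, hk, hk', fun j h1 h2 => hmem _ (hj j h1 h2)⟩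
  · have hsc : ¬ G.facePerm.SameCycle d (G.inv d) := fun h => hne (face_eq_iff.2 h)
    have key := sameCycle_mul_swap_iff hsc (ι a) (ι b)
    -- At a deleted dart the product turns around the vertex instead of running along the dart.
    have hdel : ∀ x, x = d ∨ x = G.inv d →
        (G.facePerm * swap d (G.inv d)) x = G.rot x := by
      rintro x (rfl | rfl)
      · simp
      · simp [facePerm_apply]
    have hkeep : ∀ a, (G.facePerm * swap d (G.inv d)) (ι a) = G.rot (G.inv (ι a)) := by
      intro a
      obtain ⟨h1, h2⟩ := (hr _).1 ⟨a, rfl⟩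
      rw [Perm.mul_apply, swap_apply_of_ne_of_ne h1 h2, facePerm_apply]
    have hfr := sameCycle_iff_of_firstReturn (σ := G.facePerm * swap d (G.inv d))
      (τ := H.facePerm) hι (fun a => ?_) a b
    · rw [face_eq_iff, hfr, key]
      simp only [face_eq_iff, sameCycle_comm (x := d), sameCycle_comm (x := G.inv d)]
    · obtain ⟨k, hk, hk', hj⟩ := hrot (H.inv a)
      rw [hi] at hk' hj
      have hpow : ∀ j, 0 < j → j ≤ k →
          ((G.facePerm * swap d (G.inv d)) ^ j) (ι a) = (G.rot ^ j) (G.inv (ι a)) := by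
        intro j hj0
        induction j, hj0 using Nat.le_induction with
        | base => intro _; rw [pow_one, pow_one, hkeep]
        | succ j hj0 ih =>
          intro hle
          rw [pow_succ', Perm.mul_apply, ih (by omega), hdel _ (hj j hj0 (by omega)),
            pow_succ', Perm.mul_apply]
      refine ⟨k, hk, ?_, fun j h1 h2 => ?_⟩
      · rw [hpow k hk le_rfl, ← hk', facePerm_apply]
      · rw [hpow j h1 h2.le]
        exact hmem _ (hj j h1 h2)

/-- Every edge between two different faces can be deleted. -/
theorem exists_isDeletion {d : G.Dart} (h : G.face d ≠ G.face (G.inv d)) :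
    ∃ H, IsDeletion G d H := by
  classical
  set e := G.inv d with he
  have hed : e ≠ d := G.inv_ne d
  have hdd : G.inv e = d := by simp [he]
  set σ₁ : Perm G.Dart := swap d (G.rot d) * G.rot with h1
  set σ : Perm G.Dart := swap e (σ₁ e) * σ₁ with h2
  have h1d : σ₁ d = d := by simp [h1]
  have h2d : σ d = d := by
    have h3 : d ≠ σ₁ e := fun h => hed (σ₁.injective (by rw [← h, h1d]))
    rw [h2, Perm.mul_apply, h1d, swap_apply_of_ne_of_ne hed.symm h3]
  have h2e : σ e = e := by simp [h2]
  have hp : ∀ x, (x ≠ d ∧ x ≠ e) ↔ (σ x ≠ d ∧ σ x ≠ e) := by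
    intro x
    have q1 : σ x = d ↔ x = d := by rw [← σ.injective.eq_iff (a := x), h2d]
    have q2 : σ x = e ↔ x = e := by rw [← σ.injective.eq_iff (a := x), h2e]
    rw [ne_eq, ne_eq, ne_eq, ne_eq, q1, q2]
  have hq : ∀ x, (x ≠ d ∧ x ≠ e) ↔ (G.inv x ≠ d ∧ G.inv x ≠ e) := by
    intro x
    have q1 : G.inv x = d ↔ x = e := by rw [← G.inv.injective.eq_iff (a := x), hdd]
    have q2 : G.inv x = e ↔ x = d := by rw [← G.inv.injective.eq_iff (a := x), he]
    rw [ne_eq, ne_eq, ne_eq, ne_eq, q1, q2, and_comm]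
  let H : CMap :=
    { Dart := {x : G.Dart // x ≠ d ∧ x ≠ e}
      finite := inferInstance
      rot := σ.subtypePerm (fun x => (hp x).symm)
      inv := G.inv.subtypePerm (fun x => (hq x).symm)
      inv_inv := fun x => Subtype.ext (by simp)
      inv_ne := fun x hx => G.inv_ne x.1 (by simpa using congrArg Subtype.val hx) }
  refine ⟨H, h, Subtype.val, Subtype.val_injective, fun x => ?_, fun a => rfl, ?_⟩
  · exact ⟨by rintro ⟨a, rfl⟩; exact a.2, fun hx => ⟨⟨x, hx⟩, rfl⟩⟩
  rintro ⟨x, hxd, hxe⟩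
  change ∃ k : ℕ, 0 < k ∧ σ x = (G.rot ^ k) x ∧
    ∀ j : ℕ, 0 < j → j < k → (G.rot ^ j) x = d ∨ (G.rot ^ j) x = e
  have hinj : ∀ {p q}, G.rot p = G.rot q → p = q := fun h => G.rot.injective h
  have hσ₁ : ∀ y, y ≠ d → (G.rot y = d ∧ σ₁ y = G.rot d) ∨ (G.rot y ≠ d ∧ σ₁ y = G.rot y) := by
    intro y hy
    by_cases hyd : G.rot y = d
    · exact .inl ⟨hyd, by rw [h1, Perm.mul_apply, hyd, swap_apply_left]⟩
    · refine .inr ⟨hyd, ?_⟩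
      rw [h1, Perm.mul_apply, swap_apply_of_ne_of_ne hyd fun h => hy (hinj h)]
  have hσ : (σ₁ x = e ∧ σ x = σ₁ e) ∨ (σ₁ x ≠ e ∧ σ x = σ₁ x) := by
    by_cases hxe' : σ₁ x = e
    · exact .inl ⟨hxe', by rw [h2, Perm.mul_apply, hxe', swap_apply_left]⟩
    · refine .inr ⟨hxe', ?_⟩
      rw [h2, Perm.mul_apply, swap_apply_of_ne_of_ne hxe' fun h => hxe (σ₁.injective h)]
  have p1 : ∀ j : ℕ, 0 < j → j < 2 → j = 1 := by omega
  have p2 : ∀ j : ℕ, 0 < j → j < 3 → j = 1 ∨ j = 2 := by omega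
  rcases hσ with ⟨a1, a2⟩ | ⟨a1, a2⟩ <;> rcases hσ₁ x hxd with ⟨b1, b2⟩ | ⟨b1, b2⟩
  · rcases hσ₁ e hed with ⟨c1, c2⟩ | ⟨c1, c2⟩
    · exact absurd (hinj (b1.trans c1.symm)) hxe
    · refine ⟨3, by norm_num, ?_, fun j j0 j3 => ?_⟩
      · simp only [pow_succ, pow_zero, one_mul, Perm.mul_apply]
        rw [a2, c2, b1, ← b2, a1]
      · rcases p2 j j0 j3 with rfl | rfl
        · left; simpa using b1
        · right; simp only [pow_succ, pow_zero, one_mul, Perm.mul_apply]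
          rw [b1, ← b2, a1]
  · rcases hσ₁ e hed with ⟨c1, c2⟩ | ⟨c1, c2⟩
    · refine ⟨3, by norm_num, ?_, fun j j0 j3 => ?_⟩
      · simp only [pow_succ, pow_zero, one_mul, Perm.mul_apply]
        rw [a2, c2, ← b2, a1, c1]
      · rcases p2 j j0 j3 with rfl | rfl
        · right; rw [pow_one, ← b2, a1]
        · left; simp only [pow_succ, pow_zero, one_mul, Perm.mul_apply]
          rw [← b2, a1, c1]
    · refine ⟨2, by norm_num, ?_, fun j j0 j3 => ?_⟩
      · simp only [pow_succ, pow_zero, one_mul, Perm.mul_apply]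
        rw [a2, c2, ← b2, a1]
      · rw [p1 j j0 j3]; right; rw [pow_one, ← b2, a1]
  · refine ⟨2, by norm_num, ?_, fun j j0 j3 => ?_⟩
    · simp only [pow_succ, pow_zero, one_mul, Perm.mul_apply]
      rw [a2, b2, b1]
    · rw [p1 j j0 j3]; left; rw [pow_one, b1]
  · exact ⟨1, one_pos, by rw [a2, b2, pow_one], fun j h1 h2 => by omega⟩

namespace DeletionMap

variable {d : G.Dart} {ι : H.Dart → G.Dart} (h : DeletionMap G d H ι)
include h

theorem symm : DeletionMap G (G.inv d) H ι where
  injective := h.injective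
  range_iff x := by rw [h.range_iff, inv_inv, and_comm]
  map_inv := h.map_inv
  face_ne := by rw [inv_inv]; exact h.face_ne.symm
  vert_iff := h.vert_iff
  face_iff a b := by
    rw [h.face_iff, inv_inv, or_comm (a := G.face (ι a) = G.face d),
      or_comm (a := G.face (ι b) = G.face d)]

theorem ne (a : H.Dart) : ι a ≠ d := ((h.range_iff _).1 ⟨a, rfl⟩).1

theorem ne_inv (a : H.Dart) : ι a ≠ G.inv d := ((h.range_iff _).1 ⟨a, rfl⟩).2

theorem exists_eq {x : G.Dart} (h1 : x ≠ d) (h2 : x ≠ G.inv d) : ∃ a, ι a = x :=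
  (h.range_iff x).2 ⟨h1, h2⟩

end DeletionMap

namespace DeletionMap

variable {d : G.Dart} {ι : H.Dart → G.Dart}

theorem exists_at_or (h : DeletionMap G d H ι) :
    (∃ b, G.vert (ι b) = G.vert d ∧
      (G.face (ι b) = G.face d ∨ G.face (ι b) = G.face (G.inv d))) ∨
    (G.rot d = G.inv d ∧ G.rot (G.inv d) = d) := by
  by_cases h1 : G.rot d = d
  · exact absurd (by rw [← face_rot, h1]) h.face_ne
  by_cases h2 : G.rot d = G.inv d
  · by_cases h3 : G.rot (G.inv d) = d
    · exact .inr ⟨h2, h3⟩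
    · left
      obtain ⟨b, hb⟩ := h.exists_eq h3 fun h4 => G.inv_ne d (G.rot.injective (h4.trans h2.symm))
      refine ⟨b, ?_, .inl ?_⟩
      · rw [hb, vert_rot, ← h2, vert_rot]
      · rw [hb, face_rot, inv_inv]
  · obtain ⟨b, hb⟩ := h.exists_eq h1 h2
    exact .inl ⟨b, by rw [hb, vert_rot], .inr (by rw [hb, face_rot])⟩

/-- A vertex of the deleted edge keeps a dart that belongs to one of the united faces. -/
theorem exists_at (h : DeletionMap G d H ι) {a : H.Dart}
    (ha : G.vert (ι a) = G.vert d ∨ G.face (ι a) = G.face d ∨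
      G.face (ι a) = G.face (G.inv d)) :
    ∃ b, G.vert (ι b) = G.vert d ∧
      (G.face (ι b) = G.face d ∨ G.face (ι b) = G.face (G.inv d)) := by
  refine h.exists_at_or.resolve_right ?_
  rintro ⟨h1, h2⟩
  have hn : ¬ (ι a = d ∨ ι a = G.inv d) := not_or.2 ⟨h.ne a, h.ne_inv a⟩
  have hf : ∀ x, x = d ∨ x = G.inv d → G.facePerm x = d ∨ G.facePerm x = G.inv d := by
    rintro x (rfl | rfl)
    · exact .inl h2
    · exact .inr (by rw [facePerm_inv, h1])
  rcases ha with ha | ha | ha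
  · refine hn (vert_induction (P := fun x => x = d ∨ x = G.inv d) ?_ ha.symm (.inl rfl))
    rintro x (rfl | rfl)
    · exact .inr h1
    · exact .inl h2
  · exact hn (face_induction (P := fun x => x = d ∨ x = G.inv d) hf ha.symm (.inl rfl))
  · exact hn (face_induction (P := fun x => x = d ∨ x = G.inv d) hf ha.symm (.inr rfl))

theorem exists_at_of_connected (h : DeletionMap G d H ι) (hc : G.IsConnected) (a : H.Dart) :
    ∃ b, G.vert (ι b) = G.vert d ∧
      (G.face (ι b) = G.face d ∨ G.face (ι b) = G.face (G.inv d)) := by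
  refine h.exists_at_or.resolve_right ?_
  rintro ⟨h1, h2⟩
  have hn : ¬ (ι a = d ∨ ι a = G.inv d) := not_or.2 ⟨h.ne a, h.ne_inv a⟩
  refine hn (hc.forall (P := fun x => x = d ∨ x = G.inv d) ?_ ?_ (.inl rfl) _)
  · rintro x (rfl | rfl)
    · exact .inr h1
    · exact .inl h2
  · rintro x (rfl | rfl) <;> simp

theorem exists_vert (h : DeletionMap G d H ι) (hc : G.IsConnected) (a : H.Dart) (x : G.Dart) :
    ∃ b, G.vert (ι b) = G.vert x := by
  by_cases hx : x = d
  · obtain ⟨b, hb, -⟩ := h.exists_at_of_connected hc a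
    exact ⟨b, hx ▸ hb⟩
  by_cases hx' : x = G.inv d
  · obtain ⟨b, hb, -⟩ := h.symm.exists_at_of_connected hc a
    exact ⟨b, hx' ▸ hb⟩
  · obtain ⟨b, hb⟩ := h.exists_eq hx hx'
    exact ⟨b, by rw [hb]⟩

theorem face_eq_of_mem (h : DeletionMap G d H ι) {a b : H.Dart}
    (ha : G.face (ι a) = G.face d ∨ G.face (ι a) = G.face (G.inv d))
    (hb : G.face (ι b) = G.face d ∨ G.face (ι b) = G.face (G.inv d)) : H.face a = H.face b :=
  (h.face_iff a b).2 (.inr ⟨ha, hb⟩)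

theorem isConnected (h : DeletionMap G d H ι) (hc : G.IsConnected) : H.IsConnected := by
  refine isConnected_of_forall fun P hr hi a b ha => ?_
  have hv : ∀ {x y}, G.vert (ι x) = G.vert (ι y) → P x → P y := fun hxy hx =>
    vert_induction (fun z hz => (hr z).2 hz) ((h.vert_iff _ _).2 hxy) hx
  have hf : ∀ {x y}, H.face x = H.face y → P x → P y := fun hxy hx =>
    face_induction (fun z hz => by rw [facePerm_apply]; exact (hr _).2 ((hi z).2 hz)) hxy hx
  have hd : ∀ {e}, DeletionMap G e H ι → (∃ z, G.vert (ι z) = G.vert e ∧ P z) →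
      ∃ z, G.vert (ι z) = G.vert (G.inv e) ∧ P z := by
    rintro e h' ⟨z, hz, hPz⟩
    obtain ⟨x, hx, hxf⟩ := h'.exists_at_of_connected hc a
    obtain ⟨y, hy, hyf⟩ := h'.symm.exists_at_of_connected hc a
    rw [inv_inv, or_comm] at hyf
    exact ⟨y, hy, hf (h'.face_eq_of_mem hxf hyf) (hv (hz.trans hx.symm) hPz)⟩
  have hinv : ∀ x, (∃ z, G.vert (ι z) = G.vert x ∧ P z) →
      ∃ z, G.vert (ι z) = G.vert (G.inv x) ∧ P z := fun x hx => by
    by_cases h1 : x = d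
    · subst h1
      exact hd h hx
    by_cases h2 : x = G.inv d
    · subst h2
      exact hd h.symm hx
    · obtain ⟨c, rfl⟩ := h.exists_eq h1 h2
      obtain ⟨z, hz, hPz⟩ := hx
      exact ⟨H.inv c, by rw [h.map_inv], (hi c).2 (hv hz hPz)⟩
  obtain ⟨z, hz, hPz⟩ := hc.forall (P := fun y => ∃ z, G.vert (ι z) = G.vert y ∧ P z)
    (fun x hx => by simpa using hx) hinv (a := ι a) ⟨a, rfl, ha⟩ (ι b)
  exact hv hz hPz

theorem card_vert (h : DeletionMap G d H ι) (hc : G.IsConnected) (a : H.Dart) :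
    Nat.card H.Vert = Nat.card G.Vert := by
  refine Nat.card_eq_of_bijective (Quotient.lift (fun a => G.vert (ι a))
    fun a b hab => (h.vert_iff a b).1 (Quotient.sound hab)) ⟨?_, ?_⟩
  · rintro ⟨x⟩ ⟨y⟩ hxy
    exact (h.vert_iff x y).2 hxy
  · intro v
    obtain ⟨x, rfl⟩ := vert_surjective v
    obtain ⟨b, hb⟩ := h.exists_vert hc a x
    exact ⟨H.vert b, hb⟩

theorem card_edge (h : DeletionMap G d H ι) : Nat.card G.Edge = Nat.card H.Edge + 1 := by
  rw [← Finite.card_option]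
  have hιe : ∀ a b, H.edge a = H.edge b ↔ G.edge (ι a) = G.edge (ι b) := fun a b => by
    rw [edge_eq_iff, edge_eq_iff, ← h.map_inv, h.injective.eq_iff, h.injective.eq_iff]
  have hne : ∀ a, G.edge d ≠ G.edge (ι a) := fun a hd => by
    rcases edge_eq_iff.1 hd with h1 | h1
    exacts [h.ne a h1, h.ne_inv a h1]
  refine (Nat.card_eq_of_bijective (fun o : Option H.Edge => o.elim (G.edge d)
    (Quotient.lift (fun a => G.edge (ι a))
      fun a b hab => (hιe a b).1 (Quotient.sound hab))) ⟨?_, ?_⟩).symm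
  · rintro (_ | ⟨⟨x⟩⟩) (_ | ⟨⟨y⟩⟩) hxy
    · rfl
    · exact absurd hxy (hne y)
    · exact absurd hxy.symm (hne x)
    · exact congrArg some ((hιe x y).2 hxy)
  · intro e
    obtain ⟨x, rfl⟩ := edge_surjective e
    by_cases h1 : x = d
    · exact ⟨none, by rw [h1]; rfl⟩
    by_cases h2 : x = G.inv d
    · exact ⟨none, by rw [h2]; exact edge_eq_iff.2 (.inr rfl)⟩
    · obtain ⟨b, rfl⟩ := h.exists_eq h1 h2
      exact ⟨some (H.edge b), rfl⟩

theorem card_face (h : DeletionMap G d H ι) (hc : G.IsConnected) (a : H.Dart) :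
    Nat.card G.Face = Nat.card H.Face + 1 := by
  classical
  rw [← Finite.card_option]
  -- The united face is represented by the face of `d`.
  set r : H.Dart → G.Face := fun a =>
    if G.face (ι a) = G.face (G.inv d) then G.face d else G.face (ι a) with hr
  have hri : ∀ a b, H.face a = H.face b ↔ r a = r b := fun a b => by
    rw [h.face_iff, hr]
    have := h.face_ne
    dsimp only
    split_ifs with h1 h2 h2
    · simp [h1, h2]
    · simp only [h1, or_true, true_and, h2, or_false]
      constructor
      · rintro (h3 | h3)
        exacts [absurd h3.symm h2, h3.symm]
      · exact fun h3 => .inr h3.symm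
    · simp only [h2, or_true, and_true, h1, or_false, false_or]
    · simp only [h1, h2, or_false]
      constructor
      · rintro (h3 | h3)
        exacts [h3, h3.1.trans h3.2.symm]
      · exact .inl
  have hne : ∀ a, G.face (G.inv d) ≠ r a := fun a ha => by
    rw [hr] at ha
    dsimp only at ha
    split_ifs at ha with h1
    exacts [h.face_ne ha.symm, h1 ha.symm]
  refine (Nat.card_eq_of_bijective (fun o : Option H.Face => o.elim (G.face (G.inv d))
    (Quotient.lift r fun a b hab => (hri a b).1 (Quotient.sound hab))) ⟨?_, ?_⟩).symm
  · rintro (_ | ⟨⟨x⟩⟩) (_ | ⟨⟨y⟩⟩) hxy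
    · rfl
    · exact absurd hxy (hne y)
    · exact absurd hxy.symm (hne x)
    · exact congrArg some ((hri x y).2 hxy)
  · intro f
    obtain ⟨x, rfl⟩ := face_surjective f
    by_cases h2 : G.face x = G.face (G.inv d)
    · exact ⟨none, h2.symm⟩
    by_cases h1 : G.face x = G.face d
    · obtain ⟨b, -, hb⟩ := h.exists_at_of_connected hc a
      refine ⟨some (H.face b), ?_⟩
      change r b = _
      rw [hr]
      dsimp only
      split_ifs with h3
      · exact h1.symm
      · rw [h1]; exact hb.resolve_right h3
    · obtain ⟨b, rfl⟩ := h.exists_eq (x := x) (fun e => h1 (e ▸ rfl)) (fun e => h2 (e ▸ rfl))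
      exact ⟨some (H.face b), if_neg h2⟩

theorem onTorus (h : DeletionMap G d H ι) (hG : G.OnTorus) (a : H.Dart) : H.OnTorus := by
  obtain ⟨-, hc, hχ⟩ := hG
  refine ⟨⟨a⟩, h.isConnected hc, ?_⟩
  rw [h.card_vert hc a]
  rw [h.card_edge, h.card_face hc a] at hχ
  push_cast at hχ
  omega

theorem card_dart_lt (h : DeletionMap G d H ι) : Nat.card H.Dart < Nat.card G.Dart := by
  have := Fintype.ofFinite H.Dart
  have := Fintype.ofFinite G.Dart
  rw [Nat.card_eq_fintype_card, Nat.card_eq_fintype_card]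
  refine Fintype.card_lt_of_injective_not_surjective ι h.injective fun hs => ?_
  obtain ⟨a, ha⟩ := hs d
  exact h.ne a ha

end DeletionMap

/-! ### Contraction of an edge with two ends -/

/-- The injection `ι` of the darts of `H` into those of `G` shows `H` as `G` with the edge of `d`
contracted: the faces are the same, and the two ends of the edge become one vertex. -/
def ContractionMap (G : CMap) (d : G.Dart) (H : CMap) (ι : H.Dart → G.Dart) : Prop :=
  DeletionMap G.dual d H.dual ι

theorem IsContraction.exists_contractionMap {d : G.Dart} (h : IsContraction G d H) :
    ∃ ι, ContractionMap G d H ι :=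
  IsDeletion.exists_deletionMap h

namespace ContractionMap

variable {d : G.Dart} {ι : H.Dart → G.Dart}

theorem injective (h : ContractionMap G d H ι) : Function.Injective ι :=
  DeletionMap.injective (G := G.dual) (H := H.dual) h

theorem range_iff (h : ContractionMap G d H ι) (x : G.Dart) :
    (∃ a, ι a = x) ↔ x ≠ d ∧ x ≠ G.inv d :=
  DeletionMap.range_iff (G := G.dual) (H := H.dual) h x

theorem ne (h : ContractionMap G d H ι) (a : H.Dart) : ι a ≠ d := DeletionMap.ne h a

theorem ne_inv (h : ContractionMap G d H ι) (a : H.Dart) : ι a ≠ G.inv d := DeletionMap.ne_inv h a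

theorem exists_eq (h : ContractionMap G d H ι) {x : G.Dart} (h1 : x ≠ d) (h2 : x ≠ G.inv d) :
    ∃ a, ι a = x :=
  DeletionMap.exists_eq h h1 h2

theorem map_inv (h : ContractionMap G d H ι) (a : H.Dart) : ι (H.inv a) = G.inv (ι a) :=
  DeletionMap.map_inv h a

theorem symm (h : ContractionMap G d H ι) : ContractionMap G (G.inv d) H ι := DeletionMap.symm h

theorem vert_ne (h : ContractionMap G d H ι) : G.vert d ≠ G.vert (G.inv d) := fun e =>
  DeletionMap.face_ne h (dual_face_eq_iff.2 e)

theorem face_iff (h : ContractionMap G d H ι) (a b : H.Dart) :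
    H.face a = H.face b ↔ G.face (ι a) = G.face (ι b) :=
  DeletionMap.vert_iff h a b

theorem vert_iff (h : ContractionMap G d H ι) (a b : H.Dart) :
    H.vert a = H.vert b ↔ G.vert (ι a) = G.vert (ι b) ∨
      ((G.vert (ι a) = G.vert d ∨ G.vert (ι a) = G.vert (G.inv d)) ∧
        (G.vert (ι b) = G.vert d ∨ G.vert (ι b) = G.vert (G.inv d))) :=
  dual_face_eq_iff.symm.trans ((DeletionMap.face_iff h a b).trans
    (or_congr dual_face_eq_iff (and_congr (or_congr dual_face_eq_iff dual_face_eq_iff)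
      (or_congr dual_face_eq_iff dual_face_eq_iff))))

theorem exists_at (h : ContractionMap G d H ι) {a : H.Dart}
    (ha : G.vert (ι a) = G.vert d ∨ G.vert (ι a) = G.vert (G.inv d)) :
    ∃ b, G.face (ι b) = G.face d ∧
      (G.vert (ι b) = G.vert d ∨ G.vert (ι b) = G.vert (G.inv d)) := by
  obtain ⟨b, hb, hb'⟩ := DeletionMap.exists_at h (a := a)
    (.inr (ha.imp dual_face_eq_iff.2 dual_face_eq_iff.2))
  exact ⟨b, hb, hb'.imp dual_face_eq_iff.1 dual_face_eq_iff.1⟩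

theorem onTorus (h : ContractionMap G d H ι) (hG : G.OnTorus) (a : H.Dart) : H.OnTorus := by
  have := (DeletionMap.onTorus h hG.dual a).dual
  rwa [dual_dual] at this

theorem card_dart_lt (h : ContractionMap G d H ι) : Nat.card H.Dart < Nat.card G.Dart :=
  DeletionMap.card_dart_lt (G := G.dual) (H := H.dual) h

end ContractionMap

/-! ### Maps with properly meeting faces -/

/-- A map on the torus whose faces are closed cells and meet properly.  Vertices may be 2-valent, so
these conditions survive unobstructed deletions and the coalescing of edges; together with valence
at least `3` they characterize toroidal polyhedral maps. -/
structure IsProper (G : CMap) : Prop where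
  onTorus : G.OnTorus
  closedCell : ∀ d d', G.face d = G.face d' → G.vert d = G.vert d' → d = d'
  meetProperly : ∀ f g, f ≠ g → G.MeetProperly f g

theorem IsTPM.isProper (h : G.IsTPM) : G.IsProper :=
  ⟨h.isToroidalMap.onTorus, h.isToroidalMap.closedCell, h.meetProperly⟩

theorem rot_rot_ne_of_valence (h : ∀ v, 3 ≤ G.valence v) (a : G.Dart) : G.rot (G.rot a) ≠ a := by
  intro ha
  have hs : {d | G.vert d = G.vert a} ⊆ {a, G.rot a} := by
    intro d hd
    refine vert_induction (P := fun x => x = a ∨ x = G.rot a) ?_ (Eq.symm hd) (.inl rfl)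
    rintro x (rfl | rfl)
    exacts [.inr rfl, .inl ha]
  have h1 := Set.ncard_le_ncard hs (Set.toFinite _)
  have h2 : ({a, G.rot a} : Set G.Dart).ncard ≤ 2 := (Set.ncard_insert_le _ _).trans (by simp)
  have h3 : 3 ≤ ({d | G.vert d = G.vert a} : Set G.Dart).ncard := h (G.vert a)
  omega

namespace IsProper

/-- A vertex does not meet all edges: otherwise there were at most as many edges as faces, because
each face has at most one corner at that vertex. -/
theorem not_star (h : G.IsProper) (x : G.Vert)
    (hx : ∀ y, G.vert y = x ∨ G.vert (G.inv y) = x) : False := by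
  have hy : ∀ e : G.Edge, ∃ y, G.edge y = e ∧ G.vert y = x := fun e => by
    obtain ⟨y, rfl⟩ := edge_surjective e
    rcases hx y with h1 | h1
    · exact ⟨y, rfl, h1⟩
    · exact ⟨G.inv y, (edge_eq_iff.2 (.inr rfl)).symm, h1⟩
  choose s hs hsx using hy
  have hle : Nat.card G.Edge ≤ Nat.card G.Face :=
    Nat.card_le_card_of_injective (fun e => G.face (s e)) fun e e' hee => by
      rw [← hs e, ← hs e', h.closedCell _ _ hee ((hsx e).trans (hsx e').symm)]
  have : Nonempty G.Vert := ⟨x⟩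
  have hpos : 0 < Nat.card G.Vert := Nat.card_pos
  have := h.onTorus.2.2
  omega

theorem not_forall_eq_or_eq_inv (h : G.IsProper) (y : G.Dart)
    (hy : ∀ x, x = y ∨ x = G.inv y) : False := by
  refine h.not_star (G.vert y) fun x => ?_
  rcases hy x with rfl | rfl
  · exact .inl rfl
  · exact .inr (by rw [inv_inv])

theorem vert_ne (h : G.IsProper) (y : G.Dart) : G.vert y ≠ G.vert (G.inv y) := by
  intro hy
  have h1 : G.facePerm y = y := h.closedCell _ _ (by simp) (by simp [hy])
  have h2 : G.rot y = G.inv y := by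
    rw [← facePerm_inv]
    exact h.closedCell _ _ (by simp) (by simp [hy])
  refine h.not_forall_eq_or_eq_inv y fun x => ?_
  refine h.onTorus.2.1.forall (P := fun x => x = y ∨ x = G.inv y) ?_ ?_ (.inl rfl) x
  · rintro x (rfl | rfl)
    exacts [.inr h2, .inl h1]
  · rintro x (rfl | rfl) <;> simp

theorem rot_ne (h : G.IsProper) (a : G.Dart) : G.rot a ≠ a := by
  intro ha
  have h0 : G.face (G.inv a) = G.face a := by rw [← face_rot, ha]
  have h1 : G.facePerm a = G.inv a := h.closedCell _ _ (by simp [h0]) (by simp)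
  refine h.not_forall_eq_or_eq_inv a fun x => ?_
  refine h.onTorus.2.1.forall (P := fun x => x = a ∨ x = G.inv a) ?_ ?_ (.inl rfl) x
  · rintro x (rfl | rfl)
    exacts [.inl ha, .inr h1]
  · rintro x (rfl | rfl) <;> simp

theorem face_ne (h : G.IsProper) (y : G.Dart) : G.face y ≠ G.face (G.inv y) := fun hy =>
  h.rot_ne y (h.closedCell _ _ (by rw [face_rot, hy]) (vert_rot y))

/-- Two edges with a common end and the same two faces are equal unless that end is 2-valent. -/
theorem eq_inv_of_edgeOn (h : G.IsProper) (h3 : ∀ a, G.rot (G.rot a) ≠ a) {f g : G.Face}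
    (hfg : f ≠ g) {y z : G.Dart} (hyz : G.vert (G.inv y) = G.vert z) (hyf : G.EdgeOn y f)
    (hyg : G.EdgeOn y g) (hzf : G.EdgeOn z f) (hzg : G.EdgeOn z g) : z = G.inv y := by
  wlog hy : G.face y = f generalizing f g
  · have hy' : G.face y = g := hyg.resolve_right fun e =>
      hfg ((hyf.resolve_left hy).symm.trans e)
    exact this hfg.symm hyg hyf hzg hzf hy'
  have hiy : G.face (G.inv y) = g := hyg.resolve_left fun e => hfg (hy.symm.trans e)
  rcases hzg with hz | hz
  · exact h.closedCell _ _ (hz.trans hiy.symm) hyz.symm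
  · have hzf' : G.face z = f := hzf.resolve_right fun e => hfg (e.symm.trans hz)
    have e1 : G.rot (G.inv y) = z := by
      rw [← facePerm_apply]
      exact h.closedCell _ _ (by rw [face_facePerm, hy, hzf']) (by rw [vert_facePerm, hyz])
    have e2 : G.rot z = G.inv y :=
      h.closedCell _ _ (by rw [face_rot, hz, hiy]) (by rw [vert_rot, hyz])
    exact absurd (by rw [e1, e2]) (h3 (G.inv y))

/-- If no vertex is 2-valent, two vertices common to two faces span an edge common to these faces.
-/
theorem exists_common_edge (h : G.IsProper) (h3 : ∀ a, G.rot (G.rot a) ≠ a) {f g : G.Face}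
    (hfg : f ≠ g) {v w : G.Vert} (hvf : G.VertOn v f) (hvg : G.VertOn v g) (hwf : G.VertOn w f)
    (hwg : G.VertOn w g) :
    v = w ∨ ∃ y, G.vert y = v ∧ G.vert (G.inv y) = w ∧ G.EdgeOn y f ∧ G.EdgeOn y g := by
  have hpath := h.meetProperly f g hfg v w hvf hvg hwf hwg
  clear hwf hwg
  induction hpath with
  | refl => exact .inl rfl
  | tail _ hs ih =>
    obtain ⟨z, hz1, hz2, hzf, hzg⟩ := hs
    rcases ih with rfl | ⟨y, hy1, hy2, hyf, hyg⟩
    · exact .inr ⟨z, hz1, hz2, hzf, hzg⟩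
    · have := h.eq_inv_of_edgeOn h3 hfg (hy2.trans hz1.symm) hyf hyg hzf hzg
      rw [this, inv_inv, hy1] at hz2
      exact .inl hz2

/-- An edge is determined by its two sides if no vertex is 2-valent. -/
theorem eq_of_faces_eq (h : G.IsProper) (h3 : ∀ a, G.rot (G.rot a) ≠ a) {y d : G.Dart}
    (h1 : G.face y = G.face d) (h2 : G.face (G.inv y) = G.face (G.inv d)) : y = d := by
  have hfg := h.face_ne d
  have hd1 : G.EdgeOn d (G.face d) := .inl rfl
  have hd2 : G.EdgeOn d (G.face (G.inv d)) := .inr rfl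
  have hy1 : G.EdgeOn y (G.face d) := .inl h1
  have hy2 : G.EdgeOn y (G.face (G.inv d)) := .inr h2
  have on2 : ∀ x, G.VertOn (G.vert x) (G.face (G.inv x)) := fun x => ⟨G.rot x, by simp⟩
  rcases h.exists_common_edge h3 hfg ⟨d, rfl, rfl⟩ (on2 d) ⟨y, rfl, h1⟩ (h2 ▸ on2 y) with
    hv | ⟨s, hs1, hs2, hsf, hsg⟩
  · exact h.closedCell _ _ h1 hv.symm
  · have e1 : d = s := by
      have := h.eq_inv_of_edgeOn h3 hfg (y := G.inv s) (z := d) (by rw [inv_inv, hs1])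
        (by rw [EdgeOn, inv_inv]; exact hsf.symm) (by rw [EdgeOn, inv_inv]; exact hsg.symm) hd1 hd2
      rwa [inv_inv] at this
    have e2 : y = G.inv s := h.eq_inv_of_edgeOn h3 hfg hs2 hsf hsg hy1 hy2
    rw [e2, ← e1] at h1
    exact absurd h1.symm hfg

/-- If a dart `y` is one of several with the same ends, then the next dart around its initial vertex
has these ends too. -/
theorem rot_of_multiple (h : G.IsProper) (h3 : ∀ a, G.rot (G.rot a) ≠ a) {y : G.Dart}
    (hy : ∃ y', y' ≠ y ∧ G.vert y' = G.vert y ∧ G.vert (G.inv y') = G.vert (G.inv y)) :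
    G.vert (G.inv (G.rot y)) = G.vert (G.inv y) := by
  obtain ⟨y', hne, hv, hw⟩ := hy
  have hkv : G.VertOn (G.vert y) (G.face (G.inv y)) := ⟨G.rot y, by simp⟩
  have hkw : G.VertOn (G.vert (G.inv y)) (G.face (G.inv y)) := ⟨G.inv y, rfl, rfl⟩
  have hg : ∀ z, z = y' ∨ z = G.inv y' →
      G.VertOn (G.vert y) (G.face z) ∧ G.VertOn (G.vert (G.inv y)) (G.face z) := by
    rintro z (rfl | rfl)
    · exact ⟨⟨z, hv, rfl⟩, ⟨G.facePerm z, by simp [hw], by simp⟩⟩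
    · exact ⟨⟨G.rot y', by simp [hv]⟩, ⟨G.inv y', hw, rfl⟩⟩
  -- A common edge of the face of `inv y` with another face through both ends of `y` is the
  -- successor of `y` unless it is `y` itself.
  have hs : ∀ z, z = y' ∨ z = G.inv y' → G.face (G.inv y) ≠ G.face z →
      G.vert (G.inv (G.rot y)) = G.vert (G.inv y) ∨ G.EdgeOn y (G.face z) := by
    intro z hz hkz
    rcases h.exists_common_edge h3 hkz hkv (hg z hz).1 hkw (hg z hz).2 with
      e | ⟨s, hs1, hs2, hsk, hsz⟩
    · exact absurd e (h.vert_ne y)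
    rcases hsk with hsk | hsk
    · have : s = G.rot y := h.closedCell _ _ (by simp [hsk]) (by simp [hs1])
      exact .inl (this ▸ hs2)
    · have : G.inv s = G.inv y := h.closedCell _ _ hsk hs2
      rw [G.inv_injective this] at hsz
      exact .inr hsz
  have hk' : G.face (G.inv y) ≠ G.face (G.inv y') := fun e =>
    hne (G.inv_injective (h.closedCell _ _ e hw.symm)).symm
  rcases hs _ (.inr rfl) hk' with h1 | h1
  · exact h1
  by_cases hk : G.face (G.inv y) = G.face y'
  · have : y' = G.rot y := h.closedCell _ _ (by rw [face_rot, hk]) (by rw [vert_rot, hv])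
    rw [← this, hw]
  rcases hs _ (.inl rfl) hk with h2 | h2
  · exact h2
  · have e1 := h1.resolve_right hk'
    have e2 := h2.resolve_right hk
    exact absurd (e2.symm.trans e1) (h.face_ne y')

theorem isSimple (h : G.IsProper) (h3 : ∀ a, G.rot (G.rot a) ≠ a) : G.IsSimple := by
  refine ⟨h.vert_ne, fun d d' hv hw => ?_⟩
  by_contra hne
  have key : ∀ y y', y' ≠ y → G.vert y' = G.vert y → G.vert (G.inv y') = G.vert (G.inv y) →
      ∀ z, G.vert z = G.vert y → G.vert (G.inv z) = G.vert (G.inv y) := by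
    intro y y' h1 h2 h2' z hz
    refine (vert_induction (P := fun x => G.vert x = G.vert y ∧
      G.vert (G.inv x) = G.vert (G.inv y)) ?_ hz.symm ⟨rfl, rfl⟩).2
    rintro x ⟨hx, hx'⟩
    refine ⟨by rw [vert_rot, hx], ?_⟩
    rw [h.rot_of_multiple h3, hx']
    by_cases hxy : y = x
    · subst hxy
      exact ⟨y', h1, h2, h2'⟩
    · exact ⟨y, hxy, hx.symm, hx'.symm⟩
  have k1 := key d d' (Ne.symm hne) hv.symm hw.symm
  have k2 := key (G.inv d) (G.inv d') (fun e => hne (G.inv_injective e).symm) hw.symm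
    (by rw [inv_inv, inv_inv, hv])
  rw [inv_inv] at k2
  have hall : ∀ z, G.vert z = G.vert d ∨ G.vert z = G.vert (G.inv d) :=
    h.onTorus.2.1.forall (a := d) (fun x hx => by simpa using hx)
      (fun x hx => hx.elim (fun e => .inr (k1 x e)) fun e => .inl (k2 x e)) (.inl rfl)
  exact h.not_star (G.vert d) fun z => (hall z).imp_right (k2 z)

theorem isTPM (h : G.IsProper) (h3 : ∀ a, G.rot (G.rot a) ≠ a) : G.IsTPM where
  isToroidalMap :=
    { onTorus := h.onTorus
      three_le_valence := fun v => by
        obtain ⟨a, rfl⟩ := vert_surjective v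
        have h1 : ({a, G.rot a, G.rot (G.rot a)} : Set G.Dart).ncard = 3 :=
          Set.ncard_eq_three.2 ⟨_, _, _, (h.rot_ne a).symm, (h3 a).symm, (h.rot_ne _).symm, rfl⟩
        rw [← h1]
        refine Set.ncard_le_ncard ?_ (Set.toFinite _)
        rintro x (rfl | rfl | rfl) <;> simp
      closedCell := h.closedCell }
  isSimple := h.isSimple h3
  meetProperly := h.meetProperly

end IsProper

theorem IsTPM.dual (h : G.IsTPM) : G.dual.IsTPM := by
  have hp := h.isProper
  have h3 := rot_rot_ne_of_valence h.isToroidalMap.three_le_valence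
  refine IsProper.isTPM ⟨hp.onTorus.dual, fun d d' h1 h2 => ?_, ?_⟩ ?_
  · exact hp.closedCell d d' h2 (dual_face_eq_iff.1 h1)
  · rintro f g hfg v w ⟨a, rfl, rfl⟩ ⟨b, hb, rfl⟩ ⟨a', rfl, ha'⟩ ⟨b', hb', hb''⟩
    have e1 : G.face b = G.face a := hb
    have e2 : G.face b' = G.face a' := hb'
    have e3 : G.vert a' = G.vert a := dual_face_eq_iff.1 ha'
    have e4 : G.vert b' = G.vert b := dual_face_eq_iff.1 hb''
    have e5 : G.vert a ≠ G.vert b := fun e => hfg (dual_face_eq_iff.2 e)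
    by_cases hf : G.face a = G.face a'
    · rw [show G.dual.vert a = G.dual.vert a' from hf]
    rcases hp.exists_common_edge h3 hf ⟨a, rfl, rfl⟩ ⟨a', e3, rfl⟩ ⟨b, rfl, e1⟩ ⟨b', e4, e2⟩ with
      e | ⟨y, hy1, hy2, hyf, hyg⟩
    · exact absurd e e5
    have on : ∀ z, G.vert z = G.vert a → G.vert (G.inv z) = G.vert b →
        G.dual.EdgeOn z (G.dual.face a) ∧ G.dual.EdgeOn z (G.dual.face b) := fun z h1 h2 =>
      ⟨.inl (dual_face_eq_iff.2 h1), .inr (dual_face_eq_iff.2 h2)⟩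
    have on' : ∀ z, G.vert z = G.vert b → G.vert (G.inv z) = G.vert a →
        G.dual.EdgeOn z (G.dual.face a) ∧ G.dual.EdgeOn z (G.dual.face b) := fun z h1 h2 =>
      ⟨.inr (dual_face_eq_iff.2 h2), .inl (dual_face_eq_iff.2 h1)⟩
    refine Relation.ReflTransGen.single ?_
    rcases hyf with hyf | hyf
    · exact ⟨y, hyf, hyg.resolve_left fun e => hf (hyf.symm.trans e), on y hy1 hy2⟩
    · refine ⟨G.inv y, hyf, ?_, on' (G.inv y) hy2 (by rw [inv_inv, hy1])⟩
      change G.face (G.inv (G.inv y)) = G.face a'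
      rw [inv_inv]
      exact hyg.resolve_right fun e => hf (hyf.symm.trans e)
  · intro (a : G.Dart) ha
    have ha' : G.facePerm (G.facePerm a) = a := ha
    -- A face with two sides has two edges with the same ends.
    have h1 : G.vert a = G.vert (G.inv (G.facePerm a)) := by
      rw [← vert_facePerm, ha']
    have h2 := h.isSimple.2 a (G.inv (G.facePerm a)) h1 (by rw [inv_inv, vert_facePerm])
    refine hp.face_ne a ?_
    conv_rhs => rw [h2, inv_inv, face_facePerm]

/-! ### Removable and shrinkable edges -/

/-- Some face meets both faces at the edge of `d` but contains neither end of that edge: uniting the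
two faces at `d` gives a face that meets this one improperly. -/
def DeletionObstructed (G : CMap) (d : G.Dart) : Prop :=
  ∃ x₁ x₂ z₁ z₂, G.face x₁ = G.face d ∧ G.face x₂ = G.face (G.inv d) ∧
    G.vert x₁ = G.vert z₁ ∧ G.vert x₂ = G.vert z₂ ∧ G.face z₁ = G.face z₂ ∧
    ∀ y, G.face y = G.face z₁ → G.vert y ≠ G.vert d ∧ G.vert y ≠ G.vert (G.inv d)

/-- The faces on the two sides of an edge have only the ends of the edge in common. -/
theorem IsProper.vert_eq_of_vertOn (h : G.IsProper) (h3 : ∀ a, G.rot (G.rot a) ≠ a) {d : G.Dart}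
    {x : G.Vert} (h1 : G.VertOn x (G.face d)) (h2 : G.VertOn x (G.face (G.inv d))) :
    x = G.vert d ∨ x = G.vert (G.inv d) := by
  rcases h.exists_common_edge h3 (h.face_ne d) ⟨d, rfl, rfl⟩ ⟨G.rot d, by simp⟩ h1 h2 with
    e | ⟨y, -, rfl, hy1, hy2⟩
  · exact .inl e.symm
  rcases hy1 with hy | hy
  · right
    rw [h.eq_of_faces_eq h3 hy (hy2.resolve_left fun e => h.face_ne d (hy.symm.trans e))]
  · left
    rw [h.eq_of_faces_eq h3 (y := G.inv y) hy
      (by rw [inv_inv]; exact hy2.resolve_right fun e => h.face_ne d (hy.symm.trans e))]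

namespace DeletionMap

theorem isProper {d : G.Dart} {ι : H.Dart → G.Dart} (hm : DeletionMap G d H ι)
    (h : G.IsProper) (h3 : ∀ a, G.rot (G.rot a) ≠ a) (hno : ¬ G.DeletionObstructed d) :
    H.IsProper := by
  have hne : Nonempty H.Dart := by
    by_contra hemp
    refine h.not_forall_eq_or_eq_inv d fun x => ?_
    by_contra hx
    obtain ⟨a, -⟩ := hm.exists_eq (fun e => hx (.inl e)) fun e => hx (.inr e)
    exact hemp ⟨a⟩
  obtain ⟨a₀⟩ := hne
  have hface : ∀ a b, G.face (ι a) = G.face (ι b) → H.face a = H.face b := fun a b e =>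
    (hm.face_iff a b).2 (.inl e)
  refine ⟨hm.onTorus h.onTorus a₀, fun a b hf hv => hm.injective ?_, ?_⟩
  · rw [hm.vert_iff] at hv
    by_cases hab : G.face (ι a) = G.face (ι b)
    · exact h.closedCell _ _ hab hv
    -- A vertex on both united faces is an end of the deleted edge, and there the corner of one of
    -- these faces is at a deleted dart.
    exfalso
    obtain ⟨ha, hb⟩ := ((hm.face_iff a b).1 hf).resolve_left hab
    have key : ∀ a b, G.vert (ι a) = G.vert (ι b) → G.face (ι a) = G.face d →
        G.face (ι b) = G.face (G.inv d) → False := fun a b hv ha hb => by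
      rcases h.vert_eq_of_vertOn h3 ⟨ι a, rfl, ha⟩ ⟨ι b, hv.symm, hb⟩ with e | e
      · exact hm.ne a (h.closedCell _ _ ha e)
      · exact hm.ne_inv b (h.closedCell _ _ hb (hv.symm.trans e))
    rcases ha with ha | ha <;> rcases hb with hb | hb
    · exact hab (ha.trans hb.symm)
    · exact key a b hv ha hb
    · exact key b a hv.symm hb ha
    · exact hab (ha.trans hb.symm)
  -- Two vertices of `H` common to two faces of `G` are joined along the common edge of these.
  have step : ∀ a b p q, H.face a ≠ H.face b →
      G.VertOn (G.vert (ι p)) (G.face (ι a)) → G.VertOn (G.vert (ι p)) (G.face (ι b)) →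
      G.VertOn (G.vert (ι q)) (G.face (ι a)) → G.VertOn (G.vert (ι q)) (G.face (ι b)) →
      Relation.ReflTransGen (fun x y => ∃ d, H.vert d = x ∧ H.vert (H.inv d) = y ∧
        H.EdgeOn d (H.face a) ∧ H.EdgeOn d (H.face b)) (H.vert p) (H.vert q) := by
    intro a b p q hab h1 h2 h1' h2'
    rcases h.exists_common_edge h3 (fun e => hab (hface a b e)) h1 h2 h1' h2' with
      e | ⟨y, hy1, hy2, hya, hyb⟩
    · rw [(hm.vert_iff p q).2 e]
    have hyd : ∀ e, DeletionMap G e H ι → y ≠ e := by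
      rintro e hm' rfl
      exact hab (hm'.face_eq_of_mem (hya.imp Eq.symm Eq.symm) (hyb.imp Eq.symm Eq.symm))
    obtain ⟨s, rfl⟩ := hm.exists_eq (hyd _ hm) (hyd _ hm.symm)
    rw [← hm.map_inv] at hy2
    have on : ∀ c, G.EdgeOn (ι s) (G.face (ι c)) → H.EdgeOn s (H.face c) := fun c hc =>
      hc.imp (hface _ _) fun e => hface _ _ (by rw [hm.map_inv, e])
    exact .single ⟨s, (hm.vert_iff _ _).2 hy1, (hm.vert_iff _ _).2 hy2, on a hya, on b hyb⟩
  -- The case that the first face is the united one, with the two vertices on different parts.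
  have mixed : ∀ a a' b b' : H.Dart, H.face a = H.face a' → H.face b = H.face b' →
      H.face a ≠ H.face b → H.vert a = H.vert b → H.vert a' = H.vert b' →
      G.face (ι a) ≠ G.face (ι a') →
      Relation.ReflTransGen (fun x y => ∃ d, H.vert d = x ∧ H.vert (H.inv d) = y ∧
        H.EdgeOn d (H.face a) ∧ H.EdgeOn d (H.face b)) (H.vert a) (H.vert a') := by
    intro a a' b b' hf hg hfg hv hw hne
    rw [hm.vert_iff] at hv hw
    obtain ⟨ha, ha'⟩ := ((hm.face_iff a a').1 hf).resolve_left hne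
    have hbn : ¬ (G.face (ι b) = G.face d ∨ G.face (ι b) = G.face (G.inv d)) := fun hb =>
      hfg (hm.face_eq_of_mem ha hb)
    have hbb : G.face (ι b) = G.face (ι b') :=
      ((hm.face_iff b b').1 hg).resolve_right fun e => hbn e.1
    obtain ⟨y, hyf, hyv⟩ : ∃ y, G.face y = G.face (ι b) ∧
        (G.vert y = G.vert d ∨ G.vert y = G.vert (G.inv d)) := by
      by_contra hy
      have hy' : ∀ y, G.face y = G.face (ι b) →
          G.vert y ≠ G.vert d ∧ G.vert y ≠ G.vert (G.inv d) := fun y e =>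
        ⟨fun e' => hy ⟨y, e, .inl e'⟩, fun e' => hy ⟨y, e, .inr e'⟩⟩
      rcases ha with ha | ha <;> rcases ha' with ha' | ha'
      · exact hne (ha.trans ha'.symm)
      · exact hno ⟨ι a, ι a', ι b, ι b', ha, ha', hv, hw, hbb, hy'⟩
      · exact hno ⟨ι a', ι a, ι b', ι b, ha', ha, hw, hv, hbb.symm, hbb ▸ hy'⟩
      · exact hne (ha.trans ha'.symm)
    obtain ⟨s, rfl⟩ := hm.exists_eq (x := y) (fun e => hbn (.inl (by rw [← hyf, e])))
      fun e => hbn (.inr (by rw [← hyf, e]))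
    have hs : ∀ c, (G.face (ι c) = G.face d ∨ G.face (ι c) = G.face (G.inv d)) →
        G.VertOn (G.vert (ι s)) (G.face (ι c)) := by
      rintro c (hc | hc) <;> rcases hyv with hv | hv <;> rw [hc, hv]
      exacts [⟨d, rfl, rfl⟩, ⟨G.facePerm d, by simp⟩, ⟨G.rot d, by simp⟩, ⟨_, rfl, rfl⟩]
    refine (step a b a s hfg ⟨_, rfl, rfl⟩ ⟨ι b, hv.symm, rfl⟩ (hs a ha) ⟨_, rfl, hyf⟩).trans ?_
    rw [hf, hg]
    exact step a' b' s a' (by rwa [← hf, ← hg]) (hs a' ha') ⟨_, rfl, hyf.trans hbb⟩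
      ⟨_, rfl, rfl⟩ ⟨ι b', hw.symm, rfl⟩
  rintro f g hfg v w ⟨a, rfl, rfl⟩ ⟨b, hb, rfl⟩ ⟨a', rfl, ha'⟩ ⟨b', hb', hb''⟩
  by_cases h1 : G.face (ι a) = G.face (ι a')
  · by_cases h2 : G.face (ι b) = G.face (ι b')
    · rw [hm.vert_iff] at hb hb'
      exact step a b a a' hfg ⟨_, rfl, rfl⟩ ⟨ι b, hb, rfl⟩ ⟨ι a', rfl, h1.symm⟩
        ⟨ι b', hb', h2.symm⟩
    · rw [← hb, ← hb']
      exact (mixed b b' a a' hb''.symm ha'.symm hfg.symm hb hb' h2).lift id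
        fun _ _ ⟨y, e1, e2, e3, e4⟩ => ⟨y, e1, e2, e4, e3⟩
  · exact mixed a a' b b' ha'.symm hb''.symm hfg hb.symm hb'.symm h1

end DeletionMap

/-- Contracting one of the two edges at a 2-valent vertex keeps a map proper. -/
theorem ContractionMap.isProper {a : G.Dart} {ι : H.Dart → G.Dart}
    (hm : ContractionMap G a H ι) (h : G.IsProper) (ha : G.rot (G.rot a) = a) : H.IsProper := by
  have hmem : ∀ x, G.vert x = G.vert a → x = a ∨ x = G.rot a := fun x hx => by
    refine vert_induction (P := fun x => x = a ∨ x = G.rot a) ?_ hx.symm (.inl rfl)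
    rintro x (rfl | rfl)
    exacts [.inr rfl, .inl ha]
  -- Every vertex has a dart that is not contracted.
  have hex : ∀ y, ∃ p, G.vert (ι p) = G.vert y := fun y => by
    by_cases hy : y = a ∨ y = G.inv a
    · have h1 : G.rot y ≠ y := h.rot_ne y
      have h2 : G.rot y ≠ G.inv y := fun e => h.vert_ne y (by rw [← e, vert_rot])
      obtain ⟨p, hp⟩ : ∃ p, ι p = G.rot y := by
        rcases hy with rfl | rfl
        · exact hm.exists_eq h1 h2
        · rw [inv_inv] at h2
          exact hm.exists_eq h2 h1
      exact ⟨p, by rw [hp, vert_rot]⟩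
    · obtain ⟨hy1, hy2⟩ := not_or.1 hy
      obtain ⟨p, hp⟩ := hm.exists_eq hy1 hy2
      exact ⟨p, by rw [hp]⟩
  -- The faces at the 2-valent vertex also contain the other end of the contracted edge.
  have hat : ∀ p, G.vert (ι p) = G.vert a → G.face (ι p) = G.face (G.inv a) := fun p hp => by
    rw [(hmem _ hp).resolve_left (hm.ne p), face_rot]
  refine ⟨?_, fun p q hf hv => hm.injective ?_, ?_⟩
  · obtain ⟨p, -⟩ := hex a
    exact hm.onTorus h.onTorus p
  · rw [hm.face_iff] at hf
    rcases (hm.vert_iff p q).1 hv with hv | ⟨hp | hp, hq | hq⟩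
    · exact h.closedCell _ _ hf hv
    · exact h.closedCell _ _ hf (hp.trans hq.symm)
    · exact absurd (h.closedCell _ _ (hf.symm.trans (hat p hp)) hq) (hm.ne_inv q)
    · exact absurd (h.closedCell _ _ (hf.trans (hat q hq)) hp) (hm.ne_inv p)
    · exact h.closedCell _ _ hf (hp.trans hq.symm)
  -- A vertex of `H` on two faces comes from a vertex of `G` on these faces.
  have lift : ∀ p q, H.vert p = H.vert q → ∃ c, H.vert c = H.vert p ∧
      G.VertOn (G.vert (ι c)) (G.face (ι p)) ∧ G.VertOn (G.vert (ι c)) (G.face (ι q)) := by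
    intro p q hpq
    rcases (hm.vert_iff p q).1 hpq with hv | ⟨hp | hp, hq | hq⟩
    · exact ⟨p, rfl, ⟨_, rfl, rfl⟩, ⟨ι q, hv.symm, rfl⟩⟩
    · exact ⟨p, rfl, ⟨_, rfl, rfl⟩, ⟨ι q, hq.trans hp.symm, rfl⟩⟩
    · exact ⟨q, hpq.symm, ⟨G.inv a, hq.symm, (hat p hp).symm⟩, ⟨_, rfl, rfl⟩⟩
    · exact ⟨p, rfl, ⟨_, rfl, rfl⟩, ⟨G.inv a, hp.symm, (hat q hq).symm⟩⟩
    · exact ⟨p, rfl, ⟨_, rfl, rfl⟩, ⟨ι q, hq.trans hp.symm, rfl⟩⟩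
  rintro f g hfg v w ⟨p, rfl, rfl⟩ ⟨q, hq, rfl⟩ ⟨p', rfl, hp'⟩ ⟨q', hq', hq''⟩
  obtain ⟨c, hc, hcp, hcq⟩ := lift p q hq.symm
  obtain ⟨c', hc', hcp', hcq'⟩ := lift p' q' hq'.symm
  rw [← hc, ← hc']
  rw [(hm.face_iff _ _).1 hp'] at hcp'
  rw [(hm.face_iff _ _).1 hq''] at hcq'
  have hpath := h.meetProperly _ _ (fun e => hfg ((hm.face_iff p q).2 e)) _ _ hcp hcq hcp' hcq'
  have key : ∀ X, Relation.ReflTransGen (fun x y => ∃ d, G.vert d = x ∧ G.vert (G.inv d) = y ∧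
      G.EdgeOn d (G.face (ι p)) ∧ G.EdgeOn d (G.face (ι q))) (G.vert (ι c)) X →
      ∀ e, G.vert (ι e) = X →
      Relation.ReflTransGen (fun x y => ∃ d, H.vert d = x ∧ H.vert (H.inv d) = y ∧
      H.EdgeOn d (H.face p) ∧ H.EdgeOn d (H.face q)) (H.vert c) (H.vert e) := by
    intro X hX
    induction hX with
    | refl =>
      intro e he
      rw [(hm.vert_iff e c).2 (.inl he)]
    | tail _ hs ih =>
      obtain ⟨s, rfl, rfl, hsp, hsq⟩ := hs
      intro e he
      by_cases hsa : s = a ∨ s = G.inv a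
      · obtain ⟨e₀, he₀⟩ := hex s
        rw [(hm.vert_iff e e₀).2 (.inr ?_)]
        · exact ih e₀ he₀
        · rw [he, he₀]
          rcases hsa with rfl | rfl <;> simp
      · obtain ⟨hs1, hs2⟩ := not_or.1 hsa
        obtain ⟨t, rfl⟩ : ∃ t : H.Dart, ι t = s := hm.exists_eq hs1 hs2
        have on : ∀ c, G.EdgeOn (ι t) (G.face (ι c)) → H.EdgeOn t (H.face c) := fun c hc =>
          hc.imp (hm.face_iff _ _).2 fun e => (hm.face_iff _ _).2 (by rw [hm.map_inv, e])
        refine (ih t rfl).tail ⟨t, rfl, (hm.vert_iff _ _).2 (.inl ?_), on p hsp, on q hsq⟩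
        rw [hm.map_inv, he]
  exact key _ hpath c' rfl

theorem IsProper.exists_coalesce (h : G.IsProper) {a : G.Dart} (ha : G.rot (G.rot a) = a) :
    ∃ H, Coalesce G H ∧ H.IsProper ∧ Nat.card H.Dart < Nat.card G.Dart := by
  obtain ⟨L, hL⟩ := exists_isDeletion (G := G.dual) (d := a)
    fun e => h.vert_ne a (dual_face_eq_iff.1 e)
  have hL' : IsDeletion G.dual a L.dual.dual := by rwa [dual_dual]
  obtain ⟨ι, hι⟩ := IsContraction.exists_contractionMap hL'
  exact ⟨L.dual, ⟨a, h.rot_ne a, ha, hL'⟩, hι.isProper h ha, hι.card_dart_lt⟩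

/-- Coalescing edges at 2-valent vertices turns a proper map into a toroidal polyhedral one. -/
theorem IsProper.exists_isTPM (h : G.IsProper) :
    ∃ H, Relation.ReflTransGen Coalesce G H ∧ H.IsTPM := by
  induction hn : Nat.card G.Dart using Nat.strong_induction_on generalizing G with
  | _ n ih =>
    by_cases h3 : ∀ a, G.rot (G.rot a) ≠ a
    · exact ⟨G, .refl, h.isTPM h3⟩
    · push Not at h3
      obtain ⟨a, ha⟩ := h3
      obtain ⟨K, hGK, hK, hlt⟩ := h.exists_coalesce ha
      obtain ⟨H, hKH, hH⟩ := ih _ (hn ▸ hlt) hK rfl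
      exact ⟨H, .head hGK hKH, hH⟩

/-- An edge can be removed unless its deletion makes two faces meet improperly. -/
theorem IsTPM.removable (h : G.IsTPM) {d : G.Dart} (hno : ¬ G.DeletionObstructed d) :
    G.Removable d := by
  obtain ⟨K, hK⟩ := exists_isDeletion (h.isProper.face_ne d)
  obtain ⟨ι, hι⟩ := hK.exists_deletionMap
  obtain ⟨H, hKH, hH⟩ := (hι.isProper h.isProper
    (rot_rot_ne_of_valence h.isToroidalMap.three_le_valence) hno).exists_isTPM
  exact ⟨H, hH, K, hK, hKH⟩

theorem Coalesce.dual (h : Coalesce G H) : MergeDigon G.dual H.dual := by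
  obtain ⟨a, h1, h2, h3⟩ := h
  refine ⟨a, ?_, ?_, h3⟩
  · rwa [dual_facePerm]
  · rwa [dual_facePerm, dual_facePerm]

theorem MergeDigon.dual (h : MergeDigon G H) : Coalesce G.dual H.dual := by
  obtain ⟨a, h1, h2, h3⟩ := h
  refine ⟨a, h1, h2, ?_⟩
  have key : ∀ K (e : K = G) (b : K.Dart), HEq b a → IsDeletion K b H := by
    rintro K rfl b hb
    rwa [eq_of_heq hb]
  change IsDeletion G.dual.dual a H.dual.dual
  rw [dual_dual H]
  exact key G.dual.dual (dual_dual G) a HEq.rfl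

theorem RemovesTo.dual {d : G.Dart} (h : G.RemovesTo d H) : G.dual.ShrinksTo d H.dual := by
  obtain ⟨K, hK, hKH⟩ := h
  refine ⟨K.dual, ?_, hKH.lift CMap.dual fun _ _ => Coalesce.dual⟩
  have key : ∀ L (e : L = G) (b : L.Dart), HEq b d → IsDeletion L b K := by
    rintro L rfl b hb
    rwa [eq_of_heq hb]
  change IsDeletion G.dual.dual d K.dual.dual
  rw [dual_dual K]
  exact key G.dual.dual (dual_dual G) d HEq.rfl

theorem ShrinksTo.dual {d : G.Dart} (h : G.ShrinksTo d H) : G.dual.RemovesTo d H.dual := by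
  obtain ⟨K, hK, hKH⟩ := h
  exact ⟨K.dual, hK, hKH.lift CMap.dual fun _ _ => MergeDigon.dual⟩

theorem Removable.dual {d : G.Dart} (h : G.Removable d) : G.dual.Shrinkable d := by
  obtain ⟨H, hH, hGH⟩ := h
  exact ⟨H.dual, hH.dual, hGH.dual⟩

theorem Shrinkable.dual {d : G.Dart} (h : G.Shrinkable d) : G.dual.Removable d := by
  obtain ⟨H, hH, hGH⟩ := h
  exact ⟨H.dual, hH.dual, hGH.dual⟩

theorem IsDiminimalTPM.dual (h : G.IsDiminimalTPM) : G.dual.IsDiminimalTPM := by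
  refine ⟨h.isTPM.dual, fun d hd => ?_, fun d hd => ?_⟩
  · have := hd.dual
    have key : ∀ L (e : L = G) (b : L.Dart), ¬ L.Shrinkable b := by
      rintro L rfl b
      exact h.not_shrinkable b
    exact key _ (dual_dual G) _ this
  · have := hd.dual
    have key : ∀ L (e : L = G) (b : L.Dart), ¬ L.Removable b := by
      rintro L rfl b
      exact h.not_removable b
    exact key _ (dual_dual G) _ this

/-- In a diminimal map the deletion and the contraction of every edge are obstructed. -/
theorem IsDiminimalTPM.obstructed (h : G.IsDiminimalTPM) (d : G.Dart) :
    G.DeletionObstructed d ∧ G.dual.DeletionObstructed d := by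
  constructor
  · by_contra hno
    exact h.not_removable d (h.isTPM.removable hno)
  · by_contra hno
    exact h.dual.not_removable d (h.isTPM.dual.removable hno)

/-! ### Acyclic sets of faces -/

noncomputable instance (G : CMap) : Fintype G.Dart := Fintype.ofFinite _

open Classical in
/-- The sum of `c` over the boundary walk of the face `f`. -/
noncomputable def faceSum (G : CMap) (c : G.Dart → ZMod 2) (f : G.Face) : ZMod 2 :=
  ∑ y, if G.face y = f then c y else 0

/-- The first cohomology modulo 2 of the union of the closed faces in `R` vanishes: a function of
edges whose sum over the boundary of each face in `R` is zero is on these faces the coboundary of a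
function of vertices. -/
def Acyclic (G : CMap) (R : Set G.Face) : Prop :=
  ∀ c : G.Dart → ZMod 2, (∀ y, c (G.inv y) = c y) → (∀ f ∈ R, G.faceSum c f = 0) →
    ∃ φ : G.Vert → ZMod 2, ∀ y, G.face y ∈ R → c y = φ (G.vert y) + φ (G.vert (G.inv y))

/-- Some acyclic set of faces contains all faces around both ends of some edge. -/
def HasInnerEdge (G : CMap) : Prop :=
  ∃ (R : Set G.Face) (d : G.Dart), G.Acyclic R ∧
    ∀ y, G.vert y = G.vert d ∨ G.vert y = G.vert (G.inv d) → G.face y ∈ R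

theorem faceSum_add (c c' : G.Dart → ZMod 2) (f : G.Face) :
    G.faceSum (fun y => c y + c' y) f = G.faceSum c f + G.faceSum c' f := by
  simp only [faceSum, ← Finset.sum_add_distrib]
  refine Finset.sum_congr rfl fun y _ => ?_
  split_ifs <;> simp

theorem faceSum_comp_facePerm (c : G.Dart → ZMod 2) (f : G.Face) :
    G.faceSum (fun y => c (G.facePerm y)) f = G.faceSum c f := by
  classical
  simp only [faceSum]
  rw [← Equiv.sum_comp G.facePerm (fun y => if G.face y = f then c y else 0)]
  simp only [face_facePerm]

/-- A coboundary is closed. -/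
theorem faceSum_coboundary (φ : G.Vert → ZMod 2) (f : G.Face) :
    G.faceSum (fun y => φ (G.vert y) + φ (G.vert (G.inv y))) f = 0 := by
  rw [faceSum_add]
  have := faceSum_comp_facePerm (fun y => φ (G.vert y)) f
  simp only [vert_facePerm] at this
  rw [this, CharTwo.add_self_eq_zero]

theorem sum_darts {d : G.Dart} {ι : H.Dart → G.Dart} (hι : Function.Injective ι)
    (hr : ∀ x, (∃ a, ι a = x) ↔ x ≠ d ∧ x ≠ G.inv d) (w : G.Dart → ZMod 2) :
    ∑ y, w y = w d + w (G.inv d) + ∑ b, w (ι b) := by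
  classical
  have hu : (Finset.univ : Finset G.Dart) =
      insert d (insert (G.inv d) (Finset.univ.map ⟨ι, hι⟩)) := by
    ext x
    simp only [Finset.mem_univ, Finset.mem_insert, Finset.mem_map, true_and,
      Function.Embedding.coeFn_mk, hr, true_iff]
    tauto
  have h1 : d ∉ Finset.univ.map ⟨ι, hι⟩ := by simpa using (not_congr (hr d)).2 (by simp)
  have h2 : G.inv d ∉ Finset.univ.map ⟨ι, hι⟩ := by
    simpa using (not_congr (hr (G.inv d))).2 (by simp)
  rw [hu, Finset.sum_insert, Finset.sum_insert h2, Finset.sum_map, add_assoc]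
  · rfl
  · simp only [Finset.mem_insert, not_or]
    exact ⟨(G.inv_ne d).symm, h1⟩

/-- An inner edge stays one if an edge is added across a face. -/
theorem DeletionMap.hasInnerEdge {d : G.Dart} {ι : H.Dart → G.Dart} (hm : DeletionMap G d H ι)
    (h : H.HasInnerEdge) : G.HasInnerEdge := by
  classical
  obtain ⟨R, e, hR, he⟩ := h
  set M : G.Face → Prop := fun f => f = G.face d ∨ f = G.face (G.inv d) with hM
  set R' : Set G.Face :=
    {f | ∃ a, H.face a ∈ R ∧ (G.face (ι a) = f ∨ (M (G.face (ι a)) ∧ M f))} with hR'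
  have hmem : ∀ a, G.face (ι a) ∈ R' ↔ H.face a ∈ R := fun a => by
    constructor
    · rintro ⟨b, hb, hab⟩
      rwa [← (hm.face_iff b a).2 hab]
    · exact fun ha => ⟨a, ha, .inl rfl⟩
  have hMR : ∀ f g, M f → M g → f ∈ R' → g ∈ R' := by
    rintro f g hf hg ⟨a, ha, rfl | hab⟩
    · exact ⟨a, ha, .inr ⟨hf, hg⟩⟩
    · exact ⟨a, ha, .inr ⟨hab.1, hg⟩⟩
  refine ⟨R', ι e, fun c hsymm hc => ?_, ?_⟩
  · have hc' : ∀ f ∈ R, H.faceSum (fun a => c (ι a)) f = 0 := by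
      intro f hf
      obtain ⟨a, rfl⟩ := face_surjective f
      by_cases ha : M (G.face (ι a))
      · have h1 := hc _ (hMR _ _ ha (.inl rfl) ((hmem a).2 hf))
        have h2 := hc _ (hMR _ _ ha (.inr rfl) ((hmem a).2 hf))
        have h12 : G.faceSum c (G.face d) + G.faceSum c (G.face (G.inv d)) = 0 := by
          rw [h1, h2, add_zero]
        rw [faceSum, faceSum, ← Finset.sum_add_distrib,
          sum_darts hm.injective hm.range_iff] at h12
        simp only [hm.face_ne, hm.face_ne.symm, if_true, if_false, add_zero, zero_add, hsymm,
          CharTwo.add_self_eq_zero] at h12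
        rw [← h12, faceSum]
        refine Finset.sum_congr rfl fun b _ => ?_
        have hb : H.face b = H.face a ↔ M (G.face (ι b)) := by
          rw [hm.face_iff]
          constructor
          · rintro (e | e)
            exacts [e ▸ ha, e.1]
          · exact fun e => .inr ⟨e, ha⟩
        by_cases h1 : G.face (ι b) = G.face d
        · rw [if_pos (hb.2 (.inl h1)), if_pos h1, if_neg fun e => hm.face_ne (h1.symm.trans e),
            add_zero]
        by_cases h2 : G.face (ι b) = G.face (G.inv d)
        · rw [if_pos (hb.2 (.inr h2)), if_neg h1, if_pos h2, zero_add]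
        · rw [if_neg fun e => (hb.1 e).elim h1 h2, if_neg h1, if_neg h2, add_zero]
      · have h1 := hc _ ((hmem a).2 hf)
        obtain ⟨hn1, hn2⟩ := not_or.1 ha
        rw [faceSum, sum_darts hm.injective hm.range_iff, if_neg (Ne.symm hn1),
          if_neg (Ne.symm hn2), add_zero, zero_add] at h1
        rw [← h1, faceSum]
        refine Finset.sum_congr rfl fun b _ => if_congr ?_ rfl rfl
        rw [hm.face_iff, or_iff_left fun e => ha e.2]
    obtain ⟨ψ, hψ⟩ := hR (fun a => c (ι a)) (fun a => by rw [hm.map_inv, hsymm]) hc'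
    set φ : G.Vert → ZMod 2 := fun v =>
      if h : ∃ a, G.vert (ι a) = v then ψ (H.vert h.choose) else 0 with hφ
    have hφι : ∀ a, φ (G.vert (ι a)) = ψ (H.vert a) := fun a => by
      have hex : ∃ b, G.vert (ι b) = G.vert (ι a) := ⟨a, rfl⟩
      rw [hφ]
      dsimp only
      rw [dif_pos hex, (hm.vert_iff _ _).2 hex.choose_spec]
    have hι : ∀ a, G.face (ι a) ∈ R' →
        c (ι a) = φ (G.vert (ι a)) + φ (G.vert (G.inv (ι a))) := fun a ha => by
      rw [← hm.map_inv, hφι, hφι]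
      exact hψ a ((hmem a).1 ha)
    -- At the deleted edge both sides have the same sum over one of the united faces.
    have hd : ∀ e, DeletionMap G e H ι → G.face e ∈ R' →
        c e = φ (G.vert e) + φ (G.vert (G.inv e)) := by
      intro e hm' he
      have h1 :
          G.faceSum (fun y => c y + (φ (G.vert y) + φ (G.vert (G.inv y)))) (G.face e) = 0 := by
        rw [faceSum_add, faceSum_coboundary, hc _ he, add_zero]
      rw [faceSum, sum_darts hm'.injective hm'.range_iff, if_pos rfl, if_neg hm'.face_ne.symm,
        add_zero, Finset.sum_eq_zero, add_zero] at h1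
      · exact CharTwo.add_eq_zero.1 h1
      · intro b _
        split_ifs with hb
        · rw [hι b (hb ▸ he), CharTwo.add_self_eq_zero]
        · rfl
    refine ⟨φ, fun y hy => ?_⟩
    by_cases h1 : y = d
    · subst h1
      exact hd y hm hy
    by_cases h2 : y = G.inv d
    · subst h2
      exact hd _ hm.symm hy
    · obtain ⟨a, rfl⟩ := hm.exists_eq h1 h2
      exact hι a hy
  · have key : ∀ a, (∀ b, H.vert b = H.vert a → H.face b ∈ R) →
        ∀ y, G.vert y = G.vert (ι a) → G.face y ∈ R' := by
      intro a ha y hy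
      have hdel : ∀ x, DeletionMap G x H ι → G.vert x = G.vert (ι a) → M (G.face x) →
          (∀ f, f = G.face x ∨ f = G.face (G.inv x) → M f) → G.face x ∈ R' := by
        intro x hm' hx hMx hMM
        obtain ⟨b, hb, hb'⟩ := hm'.exists_at (a := a) (.inl hx.symm)
        exact hMR _ _ (hMM _ hb') hMx ((hmem b).2 (ha b ((hm.vert_iff _ _).2 (hb.trans hx))))
      by_cases h1 : y = d
      · subst h1
        exact hdel y hm hy (.inl rfl) fun f hf => hf
      by_cases h2 : y = G.inv d
      · subst h2
        exact hdel _ hm.symm hy (.inr rfl) fun f hf => by rw [inv_inv] at hf; exact hf.symm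
      · obtain ⟨b, rfl⟩ := hm.exists_eq h1 h2
        exact (hmem b).2 (ha b ((hm.vert_iff _ _).2 hy))
    rintro y (hy | hy)
    · exact key e (fun b hb => he b (.inl hb)) y hy
    · rw [← hm.map_inv] at hy
      exact key _ (fun b hb => he b (.inr hb)) y hy

/-- An inner edge stays one if a vertex is split into the two ends of a new edge. -/
theorem ContractionMap.hasInnerEdge {d : G.Dart} {ι : H.Dart → G.Dart}
    (hm : ContractionMap G d H ι) (h : H.HasInnerEdge) : G.HasInnerEdge := by
  classical
  obtain ⟨R, e, hR, he⟩ := h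
  set R' : Set G.Face := {f | ∃ a, H.face a ∈ R ∧ G.face (ι a) = f} with hR'
  have hmem : ∀ a, G.face (ι a) ∈ R' ↔ H.face a ∈ R := fun a => by
    constructor
    · rintro ⟨b, hb, hab⟩
      rwa [← (hm.face_iff b a).2 hab]
    · exact fun ha => ⟨a, ha, rfl⟩
  set M : G.Vert → Prop := fun v => v = G.vert d ∨ v = G.vert (G.inv d) with hM
  refine ⟨R', ι e, fun c hsymm hc => ?_, ?_⟩
  · -- A coboundary is added that makes the function vanish on the contracted edge.
    set χ : G.Vert → ZMod 2 := fun v => if v = G.vert d then c d else 0 with hχ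
    set c' : G.Dart → ZMod 2 := fun y => c y + (χ (G.vert y) + χ (G.vert (G.inv y))) with hc'
    have hsymm' : ∀ y, c' (G.inv y) = c' y := fun y => by
      rw [hc']
      dsimp only
      rw [hsymm, inv_inv, add_comm (χ _)]
    have hd : c' d = 0 := by
      rw [hc', hχ]
      dsimp only
      rw [if_pos rfl, if_neg hm.vert_ne.symm, add_zero, CharTwo.add_self_eq_zero]
    have hcl : ∀ f ∈ R, H.faceSum (fun a => c' (ι a)) f = 0 := by
      intro f hf
      obtain ⟨a, rfl⟩ := face_surjective f
      have h1 : G.faceSum c' (G.face (ι a)) = 0 := by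
        rw [hc', faceSum_add, faceSum_coboundary, hc _ ((hmem a).2 hf), add_zero]
      rw [faceSum, sum_darts hm.injective hm.range_iff, hsymm', hd, ite_self,
        ite_self, add_zero, zero_add] at h1
      rw [← h1, faceSum]
      exact Finset.sum_congr rfl fun b _ => if_congr (hm.face_iff b a) rfl rfl
    obtain ⟨ψ, hψ⟩ := hR (fun a => c' (ι a)) (fun a => by rw [hm.map_inv, hsymm']) hcl
    set Q : G.Vert → H.Dart → Prop := fun v a =>
      G.vert (ι a) = v ∨ (M (G.vert (ι a)) ∧ M v) with hQ
    set φ : G.Vert → ZMod 2 := fun v =>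
      if h : ∃ a, Q v a then ψ (H.vert h.choose) else 0 with hφ
    have hφQ : ∀ v a, Q v a → φ v = ψ (H.vert a) := fun v a hva => by
      have hex : ∃ b, Q v b := ⟨a, hva⟩
      rw [hφ]
      dsimp only
      rw [dif_pos hex, (hm.vert_iff hex.choose a).2 ?_]
      rcases hva with rfl | hva
      · exact hex.choose_spec
      · rcases hex.choose_spec with h | h
        · exact .inr ⟨h.symm ▸ hva.2, hva.1⟩
        · exact .inr ⟨h.1, hva.1⟩
    have hφd : φ (G.vert d) = φ (G.vert (G.inv d)) := by
      by_cases hex : ∃ a, M (G.vert (ι a))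
      · obtain ⟨a, ha⟩ := hex
        rw [hφQ _ a (.inr ⟨ha, .inl rfl⟩), hφQ _ a (.inr ⟨ha, .inr rfl⟩)]
      · have hno : ∀ v, M v → φ v = 0 := fun v hv => by
          rw [hφ]
          refine dif_neg ?_
          rintro ⟨a, rfl | ha⟩
          exacts [hex ⟨a, hv⟩, hex ⟨a, ha.1⟩]
        rw [hno _ (.inl rfl), hno _ (.inr rfl)]
    have key : ∀ y, G.face y ∈ R' → c' y = φ (G.vert y) + φ (G.vert (G.inv y)) := by
      intro y hy
      by_cases h1 : y = d
      · rw [h1, hd, hφd, CharTwo.add_self_eq_zero]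
      by_cases h2 : y = G.inv d
      · rw [h2, hsymm', hd, inv_inv, hφd, CharTwo.add_self_eq_zero]
      · obtain ⟨a, rfl⟩ := hm.exists_eq h1 h2
        rw [← hm.map_inv, hφQ _ a (.inl rfl), hφQ _ (H.inv a) (.inl rfl)]
        exact hψ a ((hmem a).1 hy)
    refine ⟨fun v => φ v + χ v, fun y hy => ?_⟩
    have h1 := key y hy
    rw [hc'] at h1
    dsimp only at h1
    rw [CharTwo.add_eq_iff_eq_add] at h1
    rw [h1]
    ring
  · have key : ∀ a, (∀ b, H.vert b = H.vert a → H.face b ∈ R) →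
        ∀ y, G.vert y = G.vert (ι a) → G.face y ∈ R' := by
      intro a ha y hy
      have hdel : ∀ x, ContractionMap G x H ι → G.vert x = G.vert (ι a) → G.face x ∈ R' := by
        intro x hm' hx
        obtain ⟨b, hb, hb'⟩ := hm'.exists_at (a := a) (.inl hx.symm)
        rw [← hb]
        exact (hmem b).2 (ha b ((hm'.vert_iff _ _).2 (.inr ⟨hb', .inl hx.symm⟩)))
      by_cases h1 : y = d
      · subst h1
        exact hdel y hm hy
      by_cases h2 : y = G.inv d
      · subst h2
        exact hdel _ hm.symm hy
      · obtain ⟨b, rfl⟩ := hm.exists_eq h1 h2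
        exact (hmem b).2 (ha b ((hm.vert_iff _ _).2 (.inl hy)))
    rintro y (hy | hy)
    · exact key e (fun b hb => he b (.inl hb)) y hy
    · rw [← hm.map_inv] at hy
      exact key _ (fun b hb => he b (.inr hb)) y hy

theorem IsDeletion.hasInnerEdge {d : G.Dart} (h : IsDeletion G d H) (hH : H.HasInnerEdge) :
    G.HasInnerEdge :=
  let ⟨_, hι⟩ := h.exists_deletionMap
  hι.hasInnerEdge hH

theorem IsContraction.hasInnerEdge {d : G.Dart} (h : IsContraction G d H) (hH : H.HasInnerEdge) :
    G.HasInnerEdge :=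
  let ⟨_, hι⟩ := h.exists_contractionMap
  hι.hasInnerEdge hH

theorem RemovesTo.hasInnerEdge {d : G.Dart} (h : G.RemovesTo d H) (hH : H.HasInnerEdge) :
    G.HasInnerEdge := by
  obtain ⟨K, hK, hKH⟩ := h
  refine hK.hasInnerEdge ?_
  clear hK
  induction hKH using Relation.ReflTransGen.head_induction_on with
  | refl => exact hH
  | head hs _ ih =>
    obtain ⟨a, -, -, ha⟩ := hs
    exact ha.hasInnerEdge ih

theorem ShrinksTo.hasInnerEdge {d : G.Dart} (h : G.ShrinksTo d H) (hH : H.HasInnerEdge) :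
    G.HasInnerEdge := by
  obtain ⟨K, hK, hKH⟩ := h
  refine hK.hasInnerEdge ?_
  clear hK
  induction hKH using Relation.ReflTransGen.head_induction_on with
  | refl => exact hH
  | head hs _ ih =>
    obtain ⟨a, -, -, ha⟩ := hs
    exact ha.hasInnerEdge ih

/-! ### Planar regions are acyclic -/

theorem faceSum_congr {c c' : G.Dart → ZMod 2} {f : G.Face}
    (h : ∀ y, G.face y = f → c y = c' y) : G.faceSum c f = G.faceSum c' f := by
  refine Finset.sum_congr rfl fun y _ => ?_
  split_ifs with hy
  exacts [h y hy, rfl]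

open Classical in
theorem faceSum_indicator (x : G.Dart) (f : G.Face) :
    G.faceSum (fun y => if y = x then 1 else 0) f = if G.face x = f then 1 else 0 := by
  rw [faceSum, Finset.sum_eq_single x]
  · simp
  · intro y _ hy
    simp [hy]
  · simp

/-- The cochain complex of the closed faces in `R` is exact in the middle: its first map has the
constants as kernel because `R` is connected, its second map is onto because `R` is not everything,
and the dimensions agree because the Euler characteristic is `1`. -/
theorem acyclic_of_planar (hc : G.IsConnected) {R : Set G.Face} (hR : G.IsPlanarRegion R)
    (hne : Rᶜ.Nonempty) : G.Acyclic R := by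
  classical
  obtain ⟨⟨-, hconn⟩, hχ⟩ := hR
  set V : Set G.Vert := {v | ∃ d, G.vert d = v ∧ G.face d ∈ R} with hV
  set E : Set G.Edge := {e | ∃ d, G.edge d = e ∧ G.face d ∈ R} with hE
  rw [eulerChar, ← hV, ← hE] at hχ
  have : Fintype V := Fintype.ofFinite _
  have : Fintype E := Fintype.ofFinite _
  have : Fintype R := Fintype.ofFinite _
  have hyE : ∀ y, G.face y ∈ R → G.edge y ∈ E := fun y hy => ⟨y, rfl, hy⟩
  have hinvE : ∀ y, G.edge (G.inv y) = G.edge y := fun y => (edge_eq_iff.2 (.inr rfl)).symm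
  choose rep hrep using fun e : E => edge_surjective e.1
  -- Functions on the vertices and edges of the region, extended by zero.
  set X₀ := Function.ExtendByZero.linearMap (ZMod 2) (Subtype.val : V → G.Vert) with hX₀
  set X₁ := Function.ExtendByZero.linearMap (ZMod 2) (Subtype.val : E → G.Edge) with hX₁
  have hX₁a : ∀ h y (hy : G.edge y ∈ E), X₁ h (G.edge y) = h ⟨G.edge y, hy⟩ := fun h y hy =>
    Subtype.val_injective.extend_apply h 0 ⟨G.edge y, hy⟩
  have hX₀a : ∀ g (v : V), X₀ g v = g v := fun g v => Subtype.val_injective.extend_apply g 0 v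
  let D₀ : (V → ZMod 2) →ₗ[ZMod 2] (E → ZMod 2) := AddMonoidHom.toZModLinearMap 2
    (AddMonoidHom.mk' (fun g e => X₀ g (G.vert (rep e)) + X₀ g (G.vert (G.inv (rep e))))
      fun a b => by ext e; simp only [map_add, Pi.add_apply]; ring)
  let D₁ : (E → ZMod 2) →ₗ[ZMod 2] (R → ZMod 2) := AddMonoidHom.toZModLinearMap 2
    (AddMonoidHom.mk' (fun h f => G.faceSum (fun y => X₁ h (G.edge y)) f)
      fun a b => by ext f; simp only [map_add, Pi.add_apply]; exact faceSum_add _ _ _)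
  have hD₁ : ∀ h f, D₁ h f = G.faceSum (fun y => X₁ h (G.edge y)) f := fun _ _ => rfl
  have hrep' : ∀ y (hy : G.edge y ∈ E), rep ⟨G.edge y, hy⟩ = y ∨
      rep ⟨G.edge y, hy⟩ = G.inv y := fun y hy => edge_eq_iff.1 (hrep ⟨G.edge y, hy⟩).symm
  have hD₀ : ∀ g y (hy : G.edge y ∈ E),
      D₀ g ⟨G.edge y, hy⟩ = X₀ g (G.vert y) + X₀ g (G.vert (G.inv y)) := by
    intro g y hy
    change X₀ g (G.vert (rep _)) + X₀ g (G.vert (G.inv (rep _))) = _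
    rcases hrep' y hy with e | e <;> rw [e]
    rw [inv_inv, add_comm]
  have hker : Module.finrank (ZMod 2) (LinearMap.ker D₀) ≤ 1 := by
    have hle : LinearMap.ker D₀ ≤ Submodule.span (ZMod 2) {1} := by
      intro g hg
      rw [LinearMap.mem_ker] at hg
      have hface : ∀ y z, G.face y ∈ R → G.face y = G.face z →
          X₀ g (G.vert z) = X₀ g (G.vert y) := by
        intro y z hy hyz
        refine (face_induction (P := fun x => G.face x ∈ R ∧
          X₀ g (G.vert x) = X₀ g (G.vert y)) ?_ hyz ⟨hy, rfl⟩).2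
        rintro x ⟨hx, hxy⟩
        refine ⟨by rwa [face_facePerm], ?_⟩
        have := hD₀ g x (hyE x hx)
        rw [hg, Pi.zero_apply] at this
        rw [vert_facePerm, ← hxy]
        exact (CharTwo.add_eq_zero.1 this.symm).symm
      have hconst : ∀ y z, G.face y ∈ R → G.face z ∈ R →
          X₀ g (G.vert z) = X₀ g (G.vert y) := by
        intro y z hy hz
        have key : ∀ F, Relation.ReflTransGen
            (fun x y => y ∈ R ∧ ∃ v, G.VertOn v x ∧ G.VertOn v y) (G.face y) F →
            ∀ z, G.face z = F → X₀ g (G.vert z) = X₀ g (G.vert y) := by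
          intro F hF
          induction hF with
          | refl => exact fun z hz => hface y z hy hz.symm
          | tail _ hs ih =>
            rintro z rfl
            obtain ⟨hzR, v, ⟨p, rfl, hp⟩, ⟨q, hqp, hq⟩⟩ := hs
            rw [hface q z (hq ▸ hzR) hq, hqp]
            exact ih p hp
        exact key _ (hconn _ hy _ hz) z rfl
      rw [Submodule.mem_span_singleton]
      by_cases hemp : Nonempty V
      · obtain ⟨⟨v, y, rfl, hy⟩⟩ := hemp
        refine ⟨X₀ g (G.vert y), ?_⟩
        ext ⟨w, z, rfl, hz⟩
        rw [Pi.smul_apply, Pi.one_apply, smul_eq_mul, mul_one, ← hconst y z hy hz]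
        exact hX₀a g ⟨_, z, rfl, hz⟩
      · refine ⟨0, ?_⟩
        ext v
        exact absurd ⟨v⟩ hemp
    exact (Submodule.finrank_mono hle).trans
      ((finrank_span_le_card _).trans (by simp))
  have hsub : LinearMap.range D₀ ≤ LinearMap.ker D₁ := by
    rintro _ ⟨g, rfl⟩
    rw [LinearMap.mem_ker]
    ext ⟨f, hf⟩
    rw [hD₁, Pi.zero_apply, ← faceSum_coboundary (fun v => X₀ g v) f]
    refine faceSum_congr fun y hy => ?_
    rw [hX₁a _ _ (hyE y (hy ▸ hf)), hD₀]
  have hsurj : LinearMap.range D₁ = ⊤ := by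
    by_contra hlt
    obtain ⟨ψ, hψ0, hψ⟩ := Submodule.exists_le_ker_of_lt_top _ (lt_top_iff_ne_top.2 hlt)
    set s : G.Face → R → ZMod 2 := fun F F' => if F = F' then 1 else 0 with hs
    have hinv : ∀ y, G.face y ∈ R → ψ (s (G.face y)) = ψ (s (G.face (G.inv y))) := by
      intro y hy
      have h1 : D₁ (Pi.single ⟨G.edge y, hyE y hy⟩ 1) = s (G.face y) + s (G.face (G.inv y)) := by
        ext ⟨F, hF⟩
        rw [hD₁, Pi.add_apply, hs]
        dsimp only
        rw [← faceSum_indicator, ← faceSum_indicator, ← faceSum_add]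
        refine faceSum_congr fun z hz => ?_
        rw [hX₁a _ _ (hyE z (hz ▸ hF)), Pi.single_apply]
        have hyy := G.inv_ne y
        by_cases h1 : z = y
        · subst h1
          simp [hyy.symm]
        by_cases h2 : z = G.inv y
        · subst h2
          simp [hinvE, hyy]
        · rw [if_neg h1, if_neg h2, if_neg, add_zero]
          intro e
          rcases edge_eq_iff.1 (Subtype.ext_iff.1 e).symm with h | h
          exacts [h1 h, h2 h]
      have h2 : ψ (s (G.face y) + s (G.face (G.inv y))) = 0 := h1 ▸ hψ ⟨_, rfl⟩
      rw [map_add] at h2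
      exact CharTwo.add_eq_zero.1 h2
    have hzero : ∀ F, F ∉ R → s F = 0 := fun F hF => by
      ext ⟨F', hF'⟩
      exact if_neg fun e => hF (by rw [e]; exact hF')
    have hinv' : ∀ y, ψ (s (G.face y)) = ψ (s (G.face (G.inv y))) := fun y => by
      by_cases h1 : G.face y ∈ R
      · exact hinv y h1
      by_cases h2 : G.face (G.inv y) ∈ R
      · have := hinv _ h2
        rw [inv_inv] at this
        exact this.symm
      · rw [hzero _ h1, hzero _ h2]
    obtain ⟨F₀, hF₀⟩ := hne
    obtain ⟨y₀, rfl⟩ := face_surjective F₀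
    have hall : ∀ y, ψ (s (G.face y)) = 0 :=
      hc.forall (a := y₀) (fun x hx => by rw [face_rot, ← hinv', hx])
        (fun x hx => by rw [← hinv', hx]) (by rw [hzero _ hF₀, map_zero])
    refine hψ0 (LinearMap.ext fun w => ?_)
    rw [LinearMap.pi_apply_eq_sum_univ]
    refine Finset.sum_eq_zero fun F _ => ?_
    obtain ⟨y, hy⟩ := face_surjective F.1
    have : (fun j : R => if F = j then (1 : ZMod 2) else 0) = s (G.face y) := by
      ext j
      simp [hs, hy, Subtype.ext_iff]
    rw [this, hall, smul_zero]
  have hexact : LinearMap.range D₀ = LinearMap.ker D₁ := by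
    refine Submodule.eq_of_le_of_finrank_le hsub ?_
    have r₀ := LinearMap.finrank_range_add_finrank_ker D₀
    have r₁ := LinearMap.finrank_range_add_finrank_ker D₁
    rw [hsurj, finrank_top] at r₁
    rw [Module.finrank_fintype_fun_eq_card, ← Nat.card_eq_fintype_card, Nat.card_coe_set_eq]
      at r₀ r₁
    rw [Module.finrank_fintype_fun_eq_card, ← Nat.card_eq_fintype_card, Nat.card_coe_set_eq] at r₁
    omega
  intro c hsymm hcl
  obtain ⟨g, hg⟩ : (fun e : E => c (rep e)) ∈ LinearMap.range D₀ := by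
    rw [hexact, LinearMap.mem_ker]
    ext ⟨f, hf⟩
    rw [hD₁, Pi.zero_apply, ← hcl f hf]
    refine faceSum_congr fun y hy => ?_
    rw [hX₁a _ _ (hyE y (hy ▸ hf))]
    rcases hrep' y (hyE y (hy ▸ hf)) with e | e <;> rw [e]
    exact hsymm y
  refine ⟨fun v => X₀ g v, fun y hy => ?_⟩
  rw [← hD₀ g y (hyE y hy), hg]
  dsimp only
  rcases hrep' y (hyE y hy) with e | e <;> rw [e]
  exact (hsymm y).symm

theorem HasEIC.hasInnerEdge (hc : G.IsConnected) (h : G.HasEIC) : G.HasInnerEdge := by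
  obtain ⟨C, R, d, ⟨hR, hR', hC⟩, hd, hd', hCd⟩ := h
  -- No edge of the cycle is met when turning around a vertex off the cycle.
  have key : ∀ e, G.face e ∈ R → (∀ i, G.vert (C.dart i) ≠ G.vert e) →
      ∀ y, G.vert y = G.vert e → G.face y ∈ R := by
    intro e he hCe y hy
    refine (vert_induction (P := fun x => G.vert x = G.vert e ∧ G.face x ∈ R) ?_ hy.symm
      ⟨rfl, he⟩).2
    rintro x ⟨hx, hxR⟩
    refine ⟨by rw [vert_rot, hx], ?_⟩
    rw [face_rot]
    by_contra hn
    obtain ⟨i, hi⟩ := (hC x).1 fun e => hn (e.1 hxR)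
    rcases edge_eq_iff.1 hi with h1 | h1
    · exact hCe i (by rw [← h1, hx])
    · exact hCe (i + 1) (by rw [← C.closed i, ← h1, hx])
  refine ⟨R, d, acyclic_of_planar hc hR hR'.1, ?_⟩
  rintro y (hy | hy)
  · exact key d hd (fun i => (hCd i).1) y hy
  · exact key _ hd' (fun i => (hCd i).2) y hy

/-! ### Two closed curves that cross once -/

open Classical in
/-- For two darts at a vertex, the edges passed in turning from the corner of the first to the
corner of the second. -/
theorem exists_turn {x z : G.Dart} (h : G.vert x = G.vert z) :
    ∃ t : G.Dart → ZMod 2, (∀ y, G.vert y ≠ G.vert x → t y = 0) ∧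
      ∀ y, t (G.rot y) = t y + ((if G.rot y = x then 1 else 0) +
        (if G.rot y = z then 1 else 0)) := by
  refine (vert_induction (P := fun z => G.vert z = G.vert x ∧ ∃ t : G.Dart → ZMod 2,
    (∀ y, G.vert y ≠ G.vert x → t y = 0) ∧
      ∀ y, t (G.rot y) = t y + ((if G.rot y = x then 1 else 0) +
        (if G.rot y = z then 1 else 0))) ?_ h ⟨rfl, 0, by simp, fun y => ?_⟩).2
  · rintro z ⟨hz, t, h1, h2⟩
    refine ⟨by rw [vert_rot, hz], fun y => t y + if y = z then 1 else 0, fun y hy => ?_,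
      fun y => ?_⟩
    · dsimp only
      rw [h1 y hy, if_neg fun e => hy (by rw [e, hz]), add_zero]
    · dsimp only
      rw [h2, G.rot.injective.eq_iff (a := y) (b := z)]
      linear_combination CharTwo.add_self_eq_zero (if G.rot y = z then (1 : ZMod 2) else 0)
        - CharTwo.add_self_eq_zero (if y = z then (1 : ZMod 2) else 0)
  · simp [CharTwo.add_self_eq_zero]

open Classical in
theorem faceSum_turn {x z : G.Dart} {t : G.Dart → ZMod 2}
    (ht : ∀ y, t (G.rot y) = t y + ((if G.rot y = x then 1 else 0) +
      (if G.rot y = z then 1 else 0))) (f : G.Face) :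
    G.faceSum (fun y => t y + t (G.inv y)) f =
      (if G.face x = f then 1 else 0) + (if G.face z = f then 1 else 0) := by
  have h1 : ∀ y, t (G.inv y) = t (G.facePerm y) +
      ((if G.facePerm y = x then 1 else 0) + (if G.facePerm y = z then 1 else 0)) := fun y => by
    rw [facePerm_apply, ht, add_assoc, CharTwo.add_self_eq_zero, add_zero]
  simp only [h1]
  rw [faceSum_add, faceSum_add, faceSum_comp_facePerm t f, ← add_assoc,
    CharTwo.add_self_eq_zero, zero_add, faceSum_add,
    faceSum_comp_facePerm (fun y => if y = x then 1 else 0) f,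
    faceSum_comp_facePerm (fun y => if y = z then 1 else 0) f, faceSum_indicator,
    faceSum_indicator]

/-- The deletion and the contraction of an inner edge are not both obstructed.  The first
obstruction is a closed curve that crosses the edge and otherwise meets the graph in two vertices;
the second is a closed curve along the edge and across two faces.  They cross just once.  The edges
crossed by the first form a cocycle, which is a coboundary on the acyclic set, and the second curve
stays in that set. -/
theorem Acyclic.not_obstructed {R : Set G.Face} (hR : G.Acyclic R) {d : G.Dart}
    (hd : ∀ y, G.vert y = G.vert d ∨ G.vert y = G.vert (G.inv d) → G.face y ∈ R)
    (h₁ : G.DeletionObstructed d) (h₂ : G.dual.DeletionObstructed d) : False := by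
  classical
  obtain ⟨x₁, x₂, z₁, z₂, hx₁, hx₂, hv₁, hv₂, hz, hF⟩ := h₁
  obtain ⟨u₁, u₂, w₁, w₂, hu₁, hu₂, ha₁, ha₂, hw, hW⟩ :
      ∃ u₁ u₂ w₁ w₂, G.vert u₁ = G.vert d ∧ G.vert u₂ = G.vert (G.inv d) ∧
        G.face u₁ = G.face w₁ ∧ G.face u₂ = G.face w₂ ∧ G.vert w₁ = G.vert w₂ ∧
        ∀ y, G.vert y = G.vert w₁ → G.face y ≠ G.face d ∧ G.face y ≠ G.face (G.inv d) := by
    obtain ⟨u₁, u₂, w₁, w₂, e1, e2, e3, e4, e5, e6⟩ := h₂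
    exact ⟨u₁, u₂, w₁, w₂, dual_face_eq_iff.1 e1, dual_face_eq_iff.1 e2, e3, e4,
      dual_face_eq_iff.1 e5, fun y hy => e6 y (dual_face_eq_iff.2 hy)⟩
  obtain ⟨t, ht, ht'⟩ := exists_turn hv₁
  obtain ⟨r, hr, hr'⟩ := exists_turn hv₂
  set c : G.Dart → ZMod 2 := fun y => ((t y + t (G.inv y)) + (r y + r (G.inv y))) +
    ((if y = d then 1 else 0) + (if y = G.inv d then 1 else 0)) with hc
  have hinv : ∀ y, (G.inv y = d ↔ y = G.inv d) ∧ (G.inv y = G.inv d ↔ y = d) := fun y =>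
    ⟨⟨fun e => by rw [← e, inv_inv], fun e => by rw [e, inv_inv]⟩, G.inv.injective.eq_iff⟩
  obtain ⟨φ, hφ⟩ := hR c
    (fun y => by
      simp only [hc, inv_inv, hinv]
      ring)
    (fun f _ => by
      rw [hc, faceSum_add, faceSum_add, faceSum_turn ht', faceSum_turn hr', faceSum_add,
        faceSum_indicator, faceSum_indicator, hx₁, hx₂, hz]
      linear_combination CharTwo.add_self_eq_zero (if G.face d = f then (1 : ZMod 2) else 0) +
        CharTwo.add_self_eq_zero (if G.face (G.inv d) = f then (1 : ZMod 2) else 0) +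
        CharTwo.add_self_eq_zero (if G.face z₂ = f then (1 : ZMod 2) else 0))
  -- On a face not visited by the first curve the potential changes only where that curve passes
  -- through a vertex of the face.
  have hwalk : ∀ a b, G.face a = G.face b → G.face a ∈ R → G.face a ≠ G.face d →
      G.face a ≠ G.face (G.inv d) → G.face a ≠ G.face z₁ →
      φ (G.vert a) + (t a + r a) = φ (G.vert b) + (t b + r b) := by
    intro a b hab haR h1 h2 h3
    refine (face_induction (P := fun y => G.face y = G.face a ∧
      φ (G.vert a) + (t a + r a) = φ (G.vert y) + (t y + r y)) ?_ hab ⟨rfl, rfl⟩).2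
    rintro y ⟨hy, hay⟩
    refine ⟨by rw [face_facePerm, hy], ?_⟩
    have hne : ∀ x, G.face x ≠ G.face a → G.rot (G.inv y) ≠ x := fun x hx e =>
      hx (by rw [← e, ← facePerm_apply, face_facePerm, hy])
    have k := hφ y (hy ▸ haR)
    rw [hc] at k
    dsimp only at k
    rw [if_neg fun e => h1 (by rw [← hy, e]), if_neg fun e => h2 (by rw [← hy, e])] at k
    rw [hay, vert_facePerm, facePerm_apply, ht', hr', if_neg (hne x₁ (by rw [hx₁]; exact h1.symm)),
      if_neg (hne x₂ (by rw [hx₂]; exact h2.symm)), if_neg (hne z₁ h3.symm),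
      if_neg (hne z₂ (by rw [← hz]; exact h3.symm))]
    linear_combination k + CharTwo.add_self_eq_zero (φ (G.vert y))
      - CharTwo.add_self_eq_zero (t (G.inv y)) - CharTwo.add_self_eq_zero (r (G.inv y))
  have hoff : ∀ y, G.vert y = G.vert d ∨ G.vert y = G.vert (G.inv d) → t y = 0 ∧ r y = 0 := by
    intro y hy
    have e1 : G.vert x₁ ≠ G.vert y := by
      rw [hv₁]
      rcases hy with hy | hy <;> rw [hy]
      exacts [(hF z₁ rfl).1, (hF z₁ rfl).2]
    have e2 : G.vert x₂ ≠ G.vert y := by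
      rw [hv₂]
      rcases hy with hy | hy <;> rw [hy]
      exacts [(hF z₂ hz.symm).1, (hF z₂ hz.symm).2]
    exact ⟨ht y e1.symm, hr y e2.symm⟩
  have hoffw : ∀ y, G.vert y = G.vert w₁ → t y = 0 ∧ r y = 0 := fun y hy =>
    ⟨ht y fun e => (hW x₁ (e.symm.trans hy)).1 hx₁, hr y fun e => (hW x₂ (e.symm.trans hy)).2 hx₂⟩
  have hside : ∀ u w, G.vert u = G.vert d ∨ G.vert u = G.vert (G.inv d) → G.face u = G.face w →
      G.vert w = G.vert w₁ → φ (G.vert u) = φ (G.vert w₁) := by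
    intro u w hu huw hw
    have k := hwalk u w huw (hd u hu) (by rw [huw]; exact (hW w hw).1)
      (by rw [huw]; exact (hW w hw).2)
      (fun e => hu.elim (hF u e).1 (hF u e).2)
    rwa [(hoff u hu).1, (hoff u hu).2, (hoffw w hw).1, (hoffw w hw).2, add_zero, add_zero, add_zero,
      hw] at k
  have k₁ := hside u₁ w₁ (.inl hu₁) ha₁ rfl
  have k₂ := hside u₂ w₂ (.inr hu₂) ha₂ hw.symm
  have k := hφ d (hd d (.inl rfl))
  rw [← hu₁, ← hu₂, k₁, k₂, CharTwo.add_self_eq_zero, hc] at k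
  dsimp only at k
  rw [(hoff d (.inl rfl)).1, (hoff d (.inl rfl)).2, (hoff _ (.inr rfl)).1, (hoff _ (.inr rfl)).2,
    if_pos rfl, if_neg (G.inv_ne d).symm] at k
  simp at k

theorem HasInnerEdge.not_isDiminimalTPM (h : G.HasInnerEdge) : ¬ G.IsDiminimalTPM := by
  obtain ⟨R, d, hR, hd⟩ := h
  exact fun hG => hR.not_obstructed hd (hG.obstructed d).1 (hG.obstructed d).2

theorem AddsEdge.hasInnerEdge (h : AddsEdge G H) :
    (G.HasInnerEdge → H.HasInnerEdge) ∧ (G.dual.HasInnerEdge → H.dual.HasInnerEdge) := by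
  obtain ⟨-, -, d, hd, -⟩ := h
  exact ⟨hd.hasInnerEdge, hd.dual.hasInnerEdge⟩

end CMap

theorem corollary10 (G : CMap) (hG : G.IsToroidalMap) (h : G.HasEIC ∨ G.dual.HasEIC)
    (H : CMap) (hH : Relation.ReflTransGen CMap.AddsEdge G H) :
    ¬ H.IsDiminimalTPM := by
  have hc := hG.onTorus.2.1
  have key : H.HasInnerEdge ∨ H.dual.HasInnerEdge := by
    induction hH with
    | refl => exact h.imp (CMap.HasEIC.hasInnerEdge hc) (CMap.HasEIC.hasInnerEdge hc.dual)
    | tail _ hs ih => exact ih.imp hs.hasInnerEdge.1 hs.hasInnerEdge.2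
  rcases key with hk | hk
  · exact hk.not_isDiminimalTPM
  · exact fun hdim => hk.not_isDiminimalTPM hdim.dual
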